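/- Setting. Let $S$ be a finite set of states, $A$ a set of actions and $\Omega$ a measurable space of hidden task parameters. For each $(s,a)\in S\times A$ and $\omega\in\Omega$ let $p(\cdot\mid s,a,\omega)$ be a probability density (finite-valued, measurable jointly in $\omega$ and the outcome) of the outcome $z=(s',r)\in S\times\mathbb R$, next state and reward, with respect to a fixed $\sigma$-finite measure $\nu$; write $T(s'\mid s,a,\omega)$ for the probability that the next state is $s'$. Let $\pi$ be a probability measure on $\Omega$ (the prior of the task-specific model), and let $\pi(\cdot\mid z_1,\dots,z_n)\propto\prod_{t\le n}p(z_t\mid s,a,\omega)\,\pi(d\omega)$ be the posterior after observing $n$ transitions from $(s,a)$. Let $\omega_0\in\Omega$ be the parameter of the true task and $q=p(\cdot\mid s,a,\omega_0)$. - Prior-mass radius: $d_\pi=\inf\{d:\ d\ge-\ln\pi(\{\omega: D_{KL}(q\,\|\,p(\cdot\mid s,a,\omega))\le d\})\}$. - Critical upper-bracketing radius: $\varepsilon_{upper,n}(c)=\inf\frac1n\ln\sum_j\pi(\Gamma_j)^{c}\,(1+r_{ub}(\Gamma_j))^n$, the infimum being over countable measurable partitions $(\Gamma_j)$ of $\Omega$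 into non-empty cells, with $r_{ub}(\Gamma_j)=\int\sup_{\omega\in\Gamma_j}p(z\mid s,a,\omega)\,\nu(dz)-1$. - Bayesian concentration sample complexity: $f(s,a,\epsilon,\delta,\rho)$ is the least $n$ such that, if $n$ IID transitions from $(s,a)$ are observed in the task $\omega_0$, then with probability at least $1-\delta$ the posterior mass of $\{\omega:\|T(\cdot\mid s,a,\omega)-T(\cdot\mid s,a,\omega_0)\|_1<\epsilon\}$ is at least $1-\rho$ ($f=\infty$ if there is no such $n$). Lemma 4.3. There is an absolute constant $C>0$ with the following property. Take $\eta=2$, assume $\varepsilon_{upper,n}\big(\tfrac{\eta-1}{\eta-1/2}\big)\to0$ as $n\to\infty$ (the posterior is consistent), and assume $d_\pi<\infty$. Then there is a constant $K>0$, depending on the task family, $\pi$, $(s,a)$ and $\omega_0$ but not on $\epsilon,\delta,\rho$, such that for all $\epsilon>0$ and $\delta,\rho\in(0,1)$ with $\epsilon^2\delta>d_\pi$ for which (i) the prior charges every Kullback–Leibler neighbourhood of the truth, i.e. $\pi(\{\omega:D_{KL}(q\,\|\,p(\cdot\mid s,a,\omega))\le t\})>0$ for all $t>0$, or (ii) $\epsilon^2\ge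 C\,d_\pi$ (which holds in particular whenever $\delta\le 1/C$), we have $$f(s,a,\epsilon,\delta,\rho)\le K\,\frac{d_\pi+\ln\frac1\rho}{\epsilon^2\delta-d_\pi}\qquad\text{and}\qquad f(s,a,\epsilon,\delta,\rho)\le\max\Big\{K,\ C\,\frac{d_\pi+\ln\frac1\rho}{\epsilon^2\delta-d_\pi}\Big\}.$$ The same bounds hold if $\|T(\cdot\mid s,a,\omega)-T(\cdot\mid s,a,\omega_0)\|_1$ is replaced in the definition of $f$ by the $L^1(\nu)$ distance $\|p(\cdot\mid s,a,\omega)-p(\cdot\mid s,a,\omega_0)\|_1$ of the joint densities. -/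

import Mathlib

open MeasureTheory Filter Topology
open scoped ENNReal NNReal

universe u v w

/-- A family of tasks with states `S`, actions `A` and hidden parameter `ω : Ω`.  For each
state-action pair, `density s a ω` is the density `p(s', r | s, a, ω)` of the pair
(next state, reward), with respect to a fixed σ-finite measure `base`. -/
structure TaskFamily (S : Type u) (A : Type v) (Ω : Type w)
    [MeasurableSpace S] [MeasurableSpace Ω] where
  base : Measure (S × ℝ)
  sigmaFinite_base : SigmaFinite base
  density : S → A → Ω → S × ℝ → ℝ≥0
  measurable_density : ∀ s a, Measurable fun y : Ω × (S × ℝ) => density s a y.1 y.2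
  lintegral_density : ∀ s a ω, ∫⁻ z, (density s a ω z : ℝ≥0∞) ∂base = 1

namespace TaskFamily

variable {S : Type u} {A : Type v} {Ω : Type w} [MeasurableSpace S] [MeasurableSpace Ω]

/-- The law of (next state, reward) after action `a` in state `s` in the task `ω`. -/
noncomputable def law (M : TaskFamily S A Ω) (s : S) (a : A) (ω : Ω) : Measure (S × ℝ) :=
  M.base.withDensity fun z => (M.density s a ω z : ℝ≥0∞)

/-- The transition function `T(s' | s, a, ω)`. -/
noncomputable def transition (M : TaskFamily S A Ω) (s : S) (a : A) (ω : Ω) (s' : S) : ℝ :=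
  (M.law s a ω).real {z | z.1 = s'}

/-- `‖T(· | s, a, ω) - T(· | s, a, ω')‖₁`. -/
noncomputable def nextStateDist [Fintype S] (M : TaskFamily S A Ω) (s : S) (a : A)
    (ω ω' : Ω) : ℝ :=
  ∑ s', |M.transition s a ω s' - M.transition s a ω' s'|

/-- `‖p(· | s, a, ω) - p(· | s, a, ω')‖₁`, the `L¹` distance of the joint densities of next state
and reward. -/
noncomputable def outcomeDist (M : TaskFamily S A Ω) (s : S) (a : A) (ω ω' : Ω) : ℝ :=
  ∫ z, |(M.density s a ω z : ℝ) - (M.density s a ω' z : ℝ)| ∂M.base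

/-- The likelihood `∏ t, p(x t | s, a, ω)` of `n` transitions from `(s, a)`. -/
noncomputable def likelihood (M : TaskFamily S A Ω) (s : S) (a : A) {n : ℕ}
    (x : Fin n → S × ℝ) (ω : Ω) : ℝ≥0∞ :=
  ∏ t, (M.density s a ω (x t) : ℝ≥0∞)

/-- The Bayesian posterior on the hidden parameter, for the prior `π`, after observing the `n`
transitions `x` from `(s, a)`. -/
noncomputable def posterior (M : TaskFamily S A Ω) (π : Measure Ω) (s : S) (a : A) {n : ℕ}
    (x : Fin n → S × ℝ) : Measure Ω :=
  (∫⁻ ω, M.likelihood s a x ω ∂π)⁻¹ • π.withDensity (M.likelihood s a x)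

/-- The Kullback-Leibler ball `{p ∈ Γ : D_KL(q ‖ p) ≤ t}` around `q = p(· | s, a, ω₀)`. -/
def klBall (M : TaskFamily S A Ω) (s : S) (a : A) (ω₀ : Ω) (t : ℝ≥0∞) : Set Ω :=
  {ω | InformationTheory.klDiv (M.law s a ω₀) (M.law s a ω) ≤ t}

/-- The prior-mass radius `d_π = inf {d : d ≥ -ln π({p ∈ Γ : D_KL(q ‖ p) ≤ d})}` at the true
density `q = p(· | s, a, ω₀)`; it is `∞` if there is no such real number `d`. -/
noncomputable def priorMassRadius (M : TaskFamily S A Ω) (π : Measure Ω) (s : S) (a : A)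
    (ω₀ : Ω) : ℝ≥0∞ :=
  sInf {d : ℝ≥0∞ | -ENNReal.log (π (M.klBall s a ω₀ d)) ≤ (d : EReal)}

/-- The upper-bracketing radius `r_ub(B) = ∫ sup_{ω ∈ B} p(z | s, a, ω) dz - 1` of a (nonempty)
set `B` of parameters. -/
noncomputable def upperBracketingRadius (M : TaskFamily S A Ω) (s : S) (a : A)
    (B : Set Ω) : ℝ≥0∞ :=
  (∫⁻ z, (⨆ ω ∈ B, (M.density s a ω z : ℝ≥0∞)) ∂M.base) - 1

/-- The critical upper-bracketing radius with coefficient `c`,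
`ε_{upper,n}(c) = inf_{(Γ_j)} (1/n) ln ∑_j π(Γ_j)^c (1 + r_ub(Γ_j))^n`,
the infimum being over all countable measurable partitions of the parameter space. -/
noncomputable def criticalUpperBracketingRadius (M : TaskFamily S A Ω) (π : Measure Ω)
    (s : S) (a : A) (c : ℝ) (n : ℕ) : EReal :=
  ⨅ P ∈ {P : Set (Set Ω) | P.Countable ∧ (∀ B ∈ P, MeasurableSet B) ∧ Setoid.IsPartition P},
    ENNReal.log (∑' B : P, π (B : Set Ω) ^ c * (1 + M.upperBracketingRadius s a B) ^ n)
      / (n : EReal)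

/-- If `n` IID transitions from `(s, a)` are observed in the task `ω₀`, then with probability at
least `1 - δ` the posterior gives mass at least `1 - ρ` to the tasks at `dist`-distance
less than `ε` from `ω₀`. -/
def PosteriorConcentrates (M : TaskFamily S A Ω) (π : Measure Ω) (s : S) (a : A) (ω₀ : Ω)
    (dist : Ω → Ω → ℝ) (ε δ ρ : ℝ) (n : ℕ) : Prop :=
  ENNReal.ofReal (1 - δ) ≤
    Measure.pi (fun _ : Fin n => M.law s a ω₀)
      {x | ENNReal.ofReal (1 - ρ) ≤ M.posterior π s a x {ω | dist ω ω₀ < ε}}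

/-- The Bayesian concentration sample complexity `f(s, a, ε, δ, ρ)`: the least `n` for which
`PosteriorConcentrates` holds (`⊤` if there is none). -/
noncomputable def concentrationComplexity (M : TaskFamily S A Ω) (π : Measure Ω) (s : S) (a : A)
    (ω₀ : Ω) (dist : Ω → Ω → ℝ) (ε δ ρ : ℝ) : ℕ∞ :=
  ⨅ n ∈ {n : ℕ | M.PosteriorConcentrates π s a ω₀ dist ε δ ρ n}, (n : ℕ∞)

/-- `ε_{upper,n} = o(1)`, where `ε_{upper,n}` is taken at the coefficient `(η - 1)/(η - 1/2)`. -/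
def Consistent (M : TaskFamily S A Ω) (π : Measure Ω) (s : S) (a : A) (η : ℝ) : Prop :=
  Tendsto (M.criticalUpperBracketingRadius π s a ((η - 1) / (η - 1 / 2))) atTop (𝓝 0)

end TaskFamily

theorem lintegral_pi_prod_eq_pow {Z : Type*} [MeasurableSpace Z] (μ : Measure Z)
    [IsProbabilityMeasure μ] (n : ℕ) {f : Z → ℝ≥0∞} (hf : Measurable f) :
    ∫⁻ x : Fin n → Z, ∏ i, f (x i) ∂Measure.pi (fun _ => μ) = (∫⁻ z, f z ∂μ) ^ n := by
  have hind := ProbabilityTheory.iIndepFun_infinitePi (P := fun _ : Fin n => μ)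
    (X := fun _ => f) (fun _ => hf)
  rw [Measure.infinitePi_eq_pi] at hind
  rw [ProbabilityTheory.lintegral_prod_eq_prod_lintegral_of_indepFun Finset.univ
    (fun i (x : Fin n → Z) => f (x i)) hind (fun i => hf.comp (measurable_pi_apply i))]
  simp [(measurePreserving_eval (fun _ : Fin n => μ) _).lintegral_comp hf]

theorem exists_forall_pi_sum_lt {Z : Type*} [MeasurableSpace Z] (μ : Measure Z)
    [IsProbabilityMeasure μ] {g : Z → ℝ} (hg : Measurable g) (hint : Integrable g μ) {c : ℝ}
    (hc : ∫ z, g z ∂μ < c) {η : ℝ≥0∞} (hη : 0 < η) :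
    ∃ N : ℕ, ∀ n ≥ N,
      Measure.pi (fun _ : Fin n => μ) {x | n * c < ∑ i, g (x i)} ≤ η := by
  set P := Measure.infinitePi (fun _ : ℕ => μ)
  have hmp : ∀ i : ℕ, MeasurePreserving (Function.eval i) P μ :=
    fun i => measurePreserving_eval_infinitePi (fun _ : ℕ => μ) i
  have hmeas : ∀ i : ℕ, Measurable fun x : ℕ → Z => g (x i) :=
    fun i => hg.comp (measurable_pi_apply i)
  have hind := ProbabilityTheory.iIndepFun_infinitePi (P := fun _ : ℕ => μ)
    (X := fun _ => g) (fun _ => hg)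
  have hlaw : ∀ i : ℕ, P.map (fun x => g (x i)) = μ.map g := fun i => by
    rw [← (hmp i).map_eq, Measure.map_map hg (hmp i).measurable]; rfl
  have hslln := ProbabilityTheory.strong_law_ae_real (μ := P) (fun i x => g (x i))
    ((hmp 0).integrable_comp_of_integrable hint)
    (fun i j hij => hind.indepFun hij)
    (fun i => ⟨(hmeas i).aemeasurable, (hmeas 0).aemeasurable, by rw [hlaw, hlaw]⟩)
  have hmean : ∫ x, g (x 0) ∂P = ∫ z, g z ∂μ := by
    rw [← (hmp 0).map_eq, integral_map (hmp 0).measurable.aemeasurable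
      (by rw [(hmp 0).map_eq]; exact hg.aestronglyMeasurable)]
  have htim := tendstoInMeasure_of_tendsto_ae (fun n => by
    refine Measurable.aestronglyMeasurable ?_
    exact (Finset.measurable_sum _ fun i _ => hmeas i).div_const _) hslln
  have hpos : 0 < c - ∫ z, g z ∂μ := sub_pos.2 hc
  have h1 := htim (ENNReal.ofReal (c - ∫ z, g z ∂μ)) (ENNReal.ofReal_pos.2 hpos)
  obtain ⟨N, hN⟩ := eventually_atTop.1 ((tendsto_order.1 h1).2 η hη)
  refine ⟨max N 1, fun n hn => ?_⟩
  have hn1 : 1 ≤ n := le_trans (le_max_right _ _) hn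
  have hmap := Measure.map_infinitePi_infinitePi_of_inj (P := fun _ : ℕ => μ)
    (Fin.val_injective (n := n))
  rw [Measure.infinitePi_eq_pi (μ := fun _ : Fin n => μ)] at hmap
  rw [← hmap, Measure.map_apply (by fun_prop) (measurableSet_lt (by fun_prop) (by fun_prop))]
  refine le_trans (measure_mono fun x hx => ?_) (hN n (le_trans (le_max_left _ _) hn)).le
  simp only [Set.mem_preimage, Set.mem_ofPred_eq] at hx ⊢
  rw [edist_dist]
  refine ENNReal.ofReal_le_ofReal ?_
  rw [Real.dist_eq, hmean]
  refine le_trans ?_ (le_abs_self _)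
  rw [Fin.sum_univ_eq_sum_range (fun i => g (x i))] at hx
  have hnpos : (0 : ℝ) < n := by exact_mod_cast hn1
  have : c < (∑ i ∈ Finset.range n, g (x i)) / n := by rw [lt_div_iff₀ hnpos]; linarith
  linarith

theorem measurable_essSup_of_measurable_uncurry {Z Ω : Type*} [MeasurableSpace Z]
    [MeasurableSpace Ω] (π : Measure Ω) [SFinite π] {R : Ω → Z → ℝ≥0∞}
    (hR : Measurable fun y : Ω × Z => R y.1 y.2) :
    Measurable fun z => essSup (fun ω => R ω z) π := by
  refine measurable_of_Iic fun a => ?_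
  have : (fun z => essSup (fun ω => R ω z) π) ⁻¹' Set.Iic a =
      {z | π ((fun ω => (ω, z)) ⁻¹' {y : Ω × Z | a < R y.1 y.2}) = 0} := by
    ext z
    simp only [Set.mem_preimage, Set.mem_Iic, Set.mem_ofPred_eq]
    constructor
    · intro h
      have := ENNReal.ae_le_essSup (μ := π) (fun ω => R ω z)
      rw [← nonpos_iff_eq_zero]
      refine le_trans (measure_mono ?_) (le_of_eq (ae_iff.1 this))
      intro ω hω hle
      exact absurd (lt_of_lt_of_le hω (hle.trans h)) (lt_irrefl _)
    · intro h
      refine essSup_le_of_ae_le a (ae_iff.2 ?_)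
      simpa using h
  rw [this]
  exact measurable_measure_prodMk_right (measurableSet_lt measurable_const hR)
    (measurableSet_singleton 0)

theorem tsum_mul_le_rpow_half {ι : Type*} (f g : ι → ℝ≥0∞) :
    ∑' i, f i ^ (1 / 2 : ℝ) * g i ^ (1 / 2 : ℝ) ≤
      (∑' i, f i) ^ (1 / 2 : ℝ) * (∑' i, g i) ^ (1 / 2 : ℝ) := by
  refine ENNReal.summable.tsum_le_of_sum_le fun s => ?_
  have h := ENNReal.inner_le_Lp_mul_Lq s (fun i => f i ^ (1 / 2 : ℝ))
    (fun i => g i ^ (1 / 2 : ℝ)) Real.HolderConjugate.two_two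
  refine h.trans ?_
  have e : ∀ a : ℝ≥0∞, (a ^ (1 / 2 : ℝ)) ^ (2 : ℝ) = a := fun a => by
    rw [← ENNReal.rpow_mul]; norm_num
  simp only [e]
  gcongr <;> exact ENNReal.sum_le_tsum _

theorem tsum_rpow_mul_rpow_le {ι : Type*} (V w : ι → ℝ≥0∞) :
    ∑' i, V i ^ (3 / 4 : ℝ) * w i ^ (1 / 2 : ℝ) ≤
      (∑' i, V i) ^ (3 / 4 : ℝ) * (∑' i, w i) ^ (1 / 2 : ℝ) := by
  have hsplit : ∀ a : ℝ≥0∞, a ^ (3 / 4 : ℝ) = a ^ (1 / 4 : ℝ) * a ^ (1 / 2 : ℝ) := fun a => by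
    rw [← ENNReal.rpow_add_of_nonneg _ _ (by norm_num) (by norm_num)]; norm_num
  calc ∑' i, V i ^ (3 / 4 : ℝ) * w i ^ (1 / 2 : ℝ)
      ≤ ∑' i, (∑' j, V j) ^ (1 / 4 : ℝ) * (V i ^ (1 / 2 : ℝ) * w i ^ (1 / 2 : ℝ)) := by
        refine ENNReal.tsum_le_tsum fun i => ?_
        rw [hsplit, mul_assoc]
        gcongr
        exact ENNReal.le_tsum i
    _ = (∑' j, V j) ^ (1 / 4 : ℝ) * ∑' i, V i ^ (1 / 2 : ℝ) * w i ^ (1 / 2 : ℝ) :=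
        ENNReal.tsum_mul_left
    _ ≤ _ := by
        rw [hsplit (∑' i, V i), mul_assoc]
        gcongr
        exact tsum_mul_le_rpow_half V w

theorem le_rpow_mul_rpow_of_le {u T a w : ℝ≥0∞} (h₁ : u ≤ T * a)
    (h₂ : u ≤ T ^ (1 / 2 : ℝ) * w) :
    u ≤ (a ^ (2 / 3 : ℝ) * T) ^ (3 / 4 : ℝ) * w ^ (1 / 2 : ℝ) := by
  have e : u = u ^ (1 / 2 : ℝ) * u ^ (1 / 2 : ℝ) := by
    rw [← ENNReal.rpow_add_of_nonneg _ _ (by norm_num) (by norm_num)]; norm_num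
  have eT : T ^ (3 / 4 : ℝ) = T ^ (1 / 2 : ℝ) * T ^ (1 / 4 : ℝ) := by
    rw [← ENNReal.rpow_add_of_nonneg _ _ (by norm_num) (by norm_num)]; norm_num
  calc u = u ^ (1 / 2 : ℝ) * u ^ (1 / 2 : ℝ) := e
    _ ≤ (T * a) ^ (1 / 2 : ℝ) * (T ^ (1 / 2 : ℝ) * w) ^ (1 / 2 : ℝ) := by gcongr
    _ = _ := by
      rw [ENNReal.mul_rpow_of_nonneg _ _ (by norm_num), ENNReal.mul_rpow_of_nonneg _ _ (by norm_num),
        ENNReal.mul_rpow_of_nonneg _ _ (by norm_num), ← ENNReal.rpow_mul, ← ENNReal.rpow_mul,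
        eT]
      norm_num
      ring

theorem setLIntegral_prod_le_of_partition {Z Ω ι : Type*} [MeasurableSpace Z] [MeasurableSpace Ω]
    [Countable ι] (π : Measure Ω) [SFinite π] {R : Ω → Z → ℝ≥0∞}
    (hR : Measurable fun y : Ω × Z => R y.1 y.2) {F : Set Ω} (hF : MeasurableSet F)
    {Γ : ι → Set Ω} (hΓ : ∀ j, MeasurableSet (Γ j)) (hdisj : Pairwise (Function.onFun Disjoint Γ))
    (hcover : ⋃ j, Γ j = Set.univ) {n : ℕ} (x : Fin n → Z) :
    ∫⁻ ω in F, ∏ i, R ω (x i) ∂π ≤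
      (∑' j, π (Γ j) ^ (2 / 3 : ℝ) * ∏ i, essSup (fun ω => R ω (x i)) (π.restrict (Γ j)))
          ^ (3 / 4 : ℝ) *
        (∫⁻ ω in F, ∏ i, R ω (x i) ^ (1 / 2 : ℝ) ∂π) ^ (1 / 2 : ℝ) := by
  have hFU : F = ⋃ j, F ∩ Γ j := by rw [← Set.inter_iUnion, hcover, Set.inter_univ]
  have hsum : ∀ f : Ω → ℝ≥0∞, ∫⁻ ω in F, f ω ∂π = ∑' j, ∫⁻ ω in F ∩ Γ j, f ω ∂π := fun f => by
    conv_lhs => rw [hFU]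
    exact lintegral_iUnion (fun j => hF.inter (hΓ j))
      (fun i j hij => (hdisj hij).mono Set.inter_subset_right Set.inter_subset_right) f
  rw [hsum, hsum (fun ω => ∏ i, R ω (x i) ^ (1 / 2 : ℝ))]
  refine le_trans (ENNReal.tsum_le_tsum fun j => ?_) (tsum_rpow_mul_rpow_le _ _)
  set T := ∏ i, essSup (fun ω => R ω (x i)) (π.restrict (Γ j)) with hT
  have hae : ∀ᵐ ω ∂π.restrict (F ∩ Γ j), ∏ i, R ω (x i) ≤ T := by
    have h : ∀ᵐ ω ∂π.restrict (Γ j), ∀ i, R ω (x i) ≤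
        essSup (fun ω => R ω (x i)) (π.restrict (Γ j)) :=
      ae_all_iff.2 fun i => ENNReal.ae_le_essSup _
    have h' : ∀ᵐ ω ∂π.restrict (F ∩ Γ j), ∀ i, R ω (x i) ≤
        essSup (fun ω => R ω (x i)) (π.restrict (Γ j)) :=
      ae_mono (Measure.restrict_mono Set.inter_subset_right le_rfl) h
    filter_upwards [h'] with ω hω
    exact Finset.prod_le_prod' fun i _ => hω i
  refine le_rpow_mul_rpow_of_le ?_ ?_
  · calc _ ≤ ∫⁻ _ in F ∩ Γ j, T ∂π := lintegral_mono_ae hae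
      _ = T * π (F ∩ Γ j) := by simp
      _ ≤ _ := by gcongr; exact Set.inter_subset_right
  · rw [← lintegral_const_mul _ (by fun_prop)]
    refine lintegral_mono_ae (hae.mono fun ω hω => ?_)
    have e : ∀ u : ℝ≥0∞, u = u ^ (1 / 2 : ℝ) * u ^ (1 / 2 : ℝ) := fun u => by
      rw [← ENNReal.rpow_add_of_nonneg _ _ (by norm_num) (by norm_num)]; norm_num
    rw [ENNReal.prod_rpow_of_nonneg (by norm_num)]
    conv_lhs => rw [e (∏ i, R ω (x i))]
    gcongr

theorem ofReal_exp_rpow (y r : ℝ) :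
    ENNReal.ofReal (Real.exp y) ^ r = ENNReal.ofReal (Real.exp (y * r)) := by
  rw [ENNReal.ofReal_rpow_of_pos (Real.exp_pos _), ← Real.exp_mul]

theorem ofReal_exp_mul (y r : ℝ) :
    ENNReal.ofReal (Real.exp y) * ENNReal.ofReal (Real.exp r) =
      ENNReal.ofReal (Real.exp (y + r)) := by
  rw [← ENNReal.ofReal_mul (Real.exp_pos _).le, Real.exp_add]

theorem measure_ge_exp_le {X : Type*} [MeasurableSpace X] (P : Measure X) {f : X → ℝ≥0∞}
    (hf : Measurable f) {y β : ℝ} (h : ∫⁻ x, f x ∂P ≤ ENNReal.ofReal (Real.exp y)) :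
    P {x | ENNReal.ofReal (Real.exp (β + y)) ≤ f x} ≤ ENNReal.ofReal (Real.exp (-β)) := by
  refine (meas_ge_le_lintegral_div hf.aemeasurable (by simp [Real.exp_pos]) (by simp)).trans ?_
  refine ENNReal.div_le_of_le_mul (h.trans (le_of_eq ?_))
  rw [ofReal_exp_mul]
  congr 2; ring

theorem measure_setLIntegral_prod_gt_le {Z Ω ι : Type*} [MeasurableSpace Z] [MeasurableSpace Ω]
    [Countable ι] (μ : Measure Z) [IsProbabilityMeasure μ] (π : Measure Ω)
    [IsProbabilityMeasure π] {R : Ω → Z → ℝ≥0∞}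
    (hR : Measurable fun y : Ω × Z => R y.1 y.2) {F : Set Ω} (hF : MeasurableSet F)
    {Γ : ι → Set Ω} (hΓ : ∀ j, MeasurableSet (Γ j)) (hdisj : Pairwise (Function.onFun Disjoint Γ))
    (hcover : ⋃ j, Γ j = Set.univ) {n : ℕ} {κ θ : ℝ}
    (hκ : ∀ ω ∈ F, ∫⁻ z, R ω z ^ (1 / 2 : ℝ) ∂μ ≤ ENNReal.ofReal (Real.exp (-κ)))
    (hθ : ∑' j, π (Γ j) ^ (2 / 3 : ℝ) *
        (∫⁻ z, essSup (fun ω => R ω z) (π.restrict (Γ j)) ∂μ) ^ n ≤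
      ENNReal.ofReal (Real.exp (n * θ))) (β : ℝ) :
    Measure.pi (fun _ : Fin n => μ)
        {x | ENNReal.ofReal (Real.exp (5 / 4 * β + 3 / 4 * (n * θ) - n * κ / 2)) <
          ∫⁻ ω in F, ∏ i, R ω (x i) ∂π} ≤
      ENNReal.ofReal (Real.exp (-β)) + ENNReal.ofReal (Real.exp (-β)) := by
  have hRx : ∀ i : Fin n, Measurable fun y : (Fin n → Z) × Ω => R y.2 (y.1 i) := fun i =>
    hR.comp (measurable_snd.prodMk ((measurable_pi_apply i).comp measurable_fst))
  have hRω : ∀ ω, Measurable (R ω) := fun ω => hR.comp measurable_prodMk_left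
  have hsup : ∀ j, Measurable fun z => essSup (fun ω => R ω z) (π.restrict (Γ j)) :=
    fun j => measurable_essSup_of_measurable_uncurry _ hR
  set V : (Fin n → Z) → ℝ≥0∞ := fun x => ∑' j, π (Γ j) ^ (2 / 3 : ℝ) *
    ∏ i, essSup (fun ω => R ω (x i)) (π.restrict (Γ j)) with hV
  set w : (Fin n → Z) → ℝ≥0∞ := fun x => ∫⁻ ω in F, ∏ i, R ω (x i) ^ (1 / 2 : ℝ) ∂π with hw
  have hVprod : ∀ j, Measurable fun x : Fin n → Z =>
      ∏ i, essSup (fun ω => R ω (x i)) (π.restrict (Γ j)) := fun j =>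
    Finset.measurable_prod _ fun i _ => (hsup j).comp (measurable_pi_apply i)
  have hVm : Measurable V := Measurable.tsum fun j => (hVprod j).const_mul _
  have hwprod : Measurable fun y : (Fin n → Z) × Ω => ∏ i, R y.2 (y.1 i) ^ (1 / 2 : ℝ) :=
    Finset.measurable_prod _ fun i _ => (hRx i).pow_const _
  have hwm : Measurable w := hwprod.lintegral_prod_right'
  have hVint : ∫⁻ x, V x ∂Measure.pi (fun _ : Fin n => μ) ≤
      ENNReal.ofReal (Real.exp (n * θ)) := by
    refine le_trans (le_of_eq ?_) hθ
    rw [lintegral_tsum fun j => ((hVprod j).const_mul _).aemeasurable]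
    refine tsum_congr fun j => ?_
    rw [lintegral_const_mul _ (hVprod j), lintegral_pi_prod_eq_pow μ n (hsup j)]
  have hwint : ∫⁻ x, w x ∂Measure.pi (fun _ : Fin n => μ) ≤
      ENNReal.ofReal (Real.exp (-(n * κ))) := by
    rw [hw, lintegral_lintegral_swap hwprod.aemeasurable]
    calc _ ≤ ∫⁻ ω in F, ENNReal.ofReal (Real.exp (-(n * κ))) ∂π := by
          refine setLIntegral_mono' hF fun ω hω => ?_
          rw [lintegral_pi_prod_eq_pow μ n ((hRω ω).pow_const _)]
          refine (pow_le_pow_left' (hκ ω hω) n).trans (le_of_eq ?_)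
          rw [← ENNReal.ofReal_pow (Real.exp_pos _).le, ← Real.exp_nat_mul]
          congr 2; ring
      _ ≤ _ := by
          rw [setLIntegral_const]
          exact mul_le_of_le_one_right' prob_le_one
  refine le_trans (measure_mono (fun x hx => ?_)) ((measure_union_le _ _).trans
    (add_le_add (measure_ge_exp_le _ hVm (β := β) hVint)
      (measure_ge_exp_le _ hwm (β := β) hwint)))
  by_contra hcon
  simp only [Set.mem_union, Set.mem_ofPred_eq, not_or, not_le] at hcon hx
  refine absurd hx (not_lt.2 ?_)
  refine (setLIntegral_prod_le_of_partition π hR hF hΓ hdisj hcover x).trans ?_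
  calc _ ≤ ENNReal.ofReal (Real.exp (β + n * θ)) ^ (3 / 4 : ℝ) *
        ENNReal.ofReal (Real.exp (β + -(n * κ))) ^ (1 / 2 : ℝ) := by
        gcongr
        · exact hcon.1.le
        · exact hcon.2.le
    _ = _ := by
        rw [ofReal_exp_rpow, ofReal_exp_rpow, ofReal_exp_mul]
        congr 2; ring

theorem ofReal_exp_integral_le_lintegral {Ω : Type*} [MeasurableSpace Ω] (π : Measure Ω)
    [IsProbabilityMeasure π] {f : Ω → ℝ} (hf : Integrable f π) :
    ENNReal.ofReal (Real.exp (∫ ω, f ω ∂π)) ≤ ∫⁻ ω, ENNReal.ofReal (Real.exp (f ω)) ∂π := by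
  set m := ∫ ω, f ω ∂π with hm
  by_cases hfin : Integrable (fun ω => Real.exp (f ω)) π
  · have hfm : Integrable (fun ω => f ω - m) π := hf.sub (integrable_const _)
    rw [← ofReal_integral_eq_lintegral_ofReal hfin (ae_of_all _ fun _ => (Real.exp_pos _).le)]
    refine ENNReal.ofReal_le_ofReal ?_
    have h : ∫ ω, Real.exp m * (f ω - m + 1) ∂π ≤ ∫ ω, Real.exp (f ω) ∂π := by
      refine integral_mono ((hfm.add (integrable_const _)).const_mul _)
        hfin fun ω => ?_
      have := mul_le_mul_of_nonneg_left (Real.add_one_le_exp (f ω - m)) (Real.exp_pos m).le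
      rwa [← Real.exp_add, add_sub_cancel] at this
    rw [integral_const_mul, integral_add hfm (integrable_const _),
      integral_sub hf (integrable_const _)] at h
    simpa [← hm] using h
  · have : ∫⁻ ω, ENNReal.ofReal (Real.exp (f ω)) ∂π = ∞ := by
      by_contra hne
      refine hfin ⟨(Real.continuous_exp.comp_aestronglyMeasurable hf.1), ?_⟩
      rw [hasFiniteIntegral_iff_ofReal (ae_of_all _ fun _ => (Real.exp_pos _).le)]
      exact lt_top_iff_ne_top.2 hne
    rw [this]; exact le_top

theorem exists_forall_measure_lintegral_prod_lt {Z Ω : Type*} [MeasurableSpace Z]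
    [MeasurableSpace Ω] (μ : Measure Z) [IsProbabilityMeasure μ] (π : Measure Ω)
    [IsProbabilityMeasure π] {R : Ω → Z → ℝ≥0∞} {L : Ω → Z → ℝ}
    (hLm : Measurable fun y : Z × Ω => L y.2 y.1)
    (hL : Integrable (fun y : Z × Ω => L y.2 y.1) (μ.prod π))
    (hRL : ∀ᵐ z ∂μ, ∀ᵐ ω ∂π, ENNReal.ofReal (Real.exp (-L ω z)) ≤ R ω z) {c : ℝ}
    (hc : ∫ y, L y.2 y.1 ∂μ.prod π < c) {η : ℝ≥0∞} (hη : 0 < η) :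
    ∃ N : ℕ, ∀ n ≥ N, Measure.pi (fun _ : Fin n => μ)
      {x | ∫⁻ ω, ∏ i, R ω (x i) ∂π < ENNReal.ofReal (Real.exp (-(n * c)))} ≤ η := by
  set g : Z → ℝ := fun z => ∫ ω, L ω z ∂π with hg
  have hgm : Measurable g := (hLm.stronglyMeasurable.integral_prod_right').measurable
  have hgi : Integrable g μ := hL.integral_prod_left
  rw [integral_prod _ hL] at hc
  obtain ⟨N, hN⟩ := exists_forall_pi_sum_lt μ hgm hgi hc hη
  refine ⟨N, fun n hn => ?_⟩
  have hgood : ∀ᵐ x ∂Measure.pi (fun _ : Fin n => μ), ∀ i,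
      (∀ᵐ ω ∂π, ENNReal.ofReal (Real.exp (-L ω (x i))) ≤ R ω (x i)) ∧
        Integrable (fun ω => L ω (x i)) π := by
    refine ae_all_iff.2 fun i => ?_
    have := (measurePreserving_eval (fun _ : Fin n => μ) i).quasiMeasurePreserving.ae
      (hRL.and hL.prod_right_ae)
    exact this
  refine (measure_mono_ae ?_).trans (hN n hn)
  filter_upwards [hgood] with x hx hlt
  change _ < _ at hlt
  change _ < _
  by_contra hle
  refine absurd hlt (not_lt.2 ?_)
  have hneg : ∀ i, Integrable (fun ω => -L ω (x i)) π := fun i => (hx i).2.neg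
  calc ENNReal.ofReal (Real.exp (-(n * c)))
      ≤ ENNReal.ofReal (Real.exp (∫ ω, ∑ i, -L ω (x i) ∂π)) := by
        refine ENNReal.ofReal_le_ofReal (Real.exp_le_exp.2 ?_)
        rw [integral_finsetSum _ fun i _ => hneg i]
        simp only [integral_neg, Finset.sum_neg_distrib]
        exact neg_le_neg (not_lt.1 hle)
    _ ≤ ∫⁻ ω, ENNReal.ofReal (Real.exp (∑ i, -L ω (x i))) ∂π :=
        ofReal_exp_integral_le_lintegral π (integrable_finsetSum _ fun i _ => hneg i)
    _ ≤ ∫⁻ ω, ∏ i, R ω (x i) ∂π := by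
        refine lintegral_mono_ae ?_
        filter_upwards [ae_all_iff.2 fun i => (hx i).1] with ω hω
        rw [Real.exp_sum, ENNReal.ofReal_prod_of_nonneg fun i _ => (Real.exp_pos _).le]
        exact Finset.prod_le_prod' fun i _ => hω i

section Densities

variable {Z : Type*} [MeasurableSpace Z] {ν : Measure Z} {p q : Z → ℝ≥0}

theorem integrable_coe_of_lintegral_eq_one (hp : Measurable p) (h1 : ∫⁻ z, p z ∂ν = 1) :
    Integrable (fun z => (p z : ℝ)) ν := by
  refine ⟨hp.coe_nnreal_real.aestronglyMeasurable, ?_⟩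
  simp [HasFiniteIntegral, h1]

theorem integral_coe_of_lintegral_eq_one (hp : Measurable p) (h1 : ∫⁻ z, p z ∂ν = 1) :
    ∫ z, (p z : ℝ) ∂ν = 1 := by
  rw [integral_eq_lintegral_of_nonneg_ae (ae_of_all _ fun _ => NNReal.coe_nonneg _)
    hp.coe_nnreal_real.aestronglyMeasurable]
  simp [h1]

theorem isProbabilityMeasure_withDensity_coe (h1 : ∫⁻ z, p z ∂ν = 1) :
    IsProbabilityMeasure (ν.withDensity fun z => (p z : ℝ≥0∞)) :=
  ⟨by rw [withDensity_apply _ MeasurableSet.univ, Measure.restrict_univ, h1]⟩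

theorem integrable_sqrt_mul_sqrt (hp : Measurable p) (hq : Measurable q)
    (hp1 : ∫⁻ z, p z ∂ν = 1) (hq1 : ∫⁻ z, q z ∂ν = 1) :
    Integrable (fun z => √(p z : ℝ) * √(q z : ℝ)) ν := by
  refine ((integrable_coe_of_lintegral_eq_one hp hp1).add
    (integrable_coe_of_lintegral_eq_one hq hq1)).mono'
    (hp.coe_nnreal_real.sqrt.mul hq.coe_nnreal_real.sqrt).aestronglyMeasurable
    (ae_of_all _ fun z => ?_)
  rw [Real.norm_of_nonneg (by positivity)]
  have h1 := Real.sq_sqrt (p z).coe_nonneg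
  have h2 := Real.sq_sqrt (q z).coe_nonneg
  simp only [Pi.add_apply]
  nlinarith [sq_nonneg (√(p z : ℝ) - √(q z : ℝ)), sq_nonneg (√(p z : ℝ) + √(q z : ℝ))]

/-- The `L¹` distance is controlled by the Hellinger affinity. -/
theorem integral_abs_sub_le_affinity (hp : Measurable p) (hq : Measurable q)
    (hp1 : ∫⁻ z, p z ∂ν = 1) (hq1 : ∫⁻ z, q z ∂ν = 1) {l : ℝ} (hl : 0 < l) :
    ∫ z, |(p z : ℝ) - q z| ∂ν ≤ l * (1 - ∫ z, √(p z : ℝ) * √(q z : ℝ) ∂ν) + 2 / l := by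
  have hpi := integrable_coe_of_lintegral_eq_one hp hp1
  have hqi := integrable_coe_of_lintegral_eq_one hq hq1
  have hai := integrable_sqrt_mul_sqrt hp hq hp1 hq1
  have hpq : Integrable (fun z => (p z : ℝ) + q z) ν := hpi.add hqi
  have hi1 : Integrable (fun z => (l / 2 + 1 / l) * ((p z : ℝ) + q z)) ν := hpq.const_mul _
  have hi2 : Integrable (fun z => l * (√(p z : ℝ) * √(q z : ℝ))) ν := hai.const_mul _
  have key : ∫ z, |(p z : ℝ) - q z| ∂ν ≤
      ∫ z, ((l / 2 + 1 / l) * ((p z : ℝ) + q z) - l * (√(p z : ℝ) * √(q z : ℝ))) ∂ν := by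
    refine integral_mono (hpi.sub hqi).abs (hi1.sub hi2) fun z => ?_
    set a := √(p z : ℝ)
    set b := √(q z : ℝ)
    have h1 : a ^ 2 = p z := Real.sq_sqrt (p z).coe_nonneg
    have h2 : b ^ 2 = q z := Real.sq_sqrt (q z).coe_nonneg
    have ha : 0 ≤ a := Real.sqrt_nonneg _
    have hb : 0 ≤ b := Real.sqrt_nonneg _
    simp only []
    rw [← h1, ← h2]
    have e : |a ^ 2 - b ^ 2| = |a - b| * (a + b) := by
      rw [show a ^ 2 - b ^ 2 = (a - b) * (a + b) by ring, abs_mul, abs_of_nonneg (add_nonneg ha hb)]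
    have e2 : (l / 2 + 1 / l) * (a ^ 2 + b ^ 2) - l * (a * b) =
        l / 2 * |a - b| ^ 2 + (a + b) ^ 2 / (2 * l) + (a - b) ^ 2 / (2 * l) := by
      rw [sq_abs]; field_simp; ring
    have e3 : l / 2 * |a - b| ^ 2 + (a + b) ^ 2 / (2 * l) - |a - b| * (a + b) =
        (l * |a - b| - (a + b)) ^ 2 / (2 * l) := by field_simp; ring
    have e4 : 0 ≤ (l * |a - b| - (a + b)) ^ 2 / (2 * l) := by positivity
    have e5 : 0 ≤ (a - b) ^ 2 / (2 * l) := by positivity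
    rw [e, e2]; linarith
  rw [integral_sub hi1 hi2, integral_const_mul, integral_const_mul, integral_add hpi hqi,
    integral_coe_of_lintegral_eq_one hp hp1, integral_coe_of_lintegral_eq_one hq hq1] at key
  refine key.trans (le_of_eq ?_)
  field_simp; ring

theorem integral_abs_sub_le_two (hp : Measurable p) (hq : Measurable q)
    (hp1 : ∫⁻ z, p z ∂ν = 1) (hq1 : ∫⁻ z, q z ∂ν = 1) :
    ∫ z, |(p z : ℝ) - q z| ∂ν ≤ 2 := by
  have hpi := integrable_coe_of_lintegral_eq_one hp hp1
  have hqi := integrable_coe_of_lintegral_eq_one hq hq1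
  calc _ ≤ ∫ z, ((p z : ℝ) + q z) ∂ν := by
        refine integral_mono (hpi.sub hqi).abs (hpi.add hqi) fun z => ?_
        have h1 := (p z).coe_nonneg
        have h2 := (q z).coe_nonneg
        exact abs_le.2 ⟨by linarith, by linarith⟩
    _ = 2 := by
        rw [integral_add hpi hqi, integral_coe_of_lintegral_eq_one hp hp1,
          integral_coe_of_lintegral_eq_one hq hq1]
        norm_num

theorem lintegral_sqrt_ratio_le (hp : Measurable p) (hq : Measurable q)
    (hp1 : ∫⁻ z, p z ∂ν = 1) (hq1 : ∫⁻ z, q z ∂ν = 1) :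
    ∫⁻ z, ((p z : ℝ≥0∞) / q z) ^ (1 / 2 : ℝ) ∂ν.withDensity (fun z => (q z : ℝ≥0∞)) ≤
      ENNReal.ofReal (∫ z, √(p z : ℝ) * √(q z : ℝ) ∂ν) := by
  rw [lintegral_withDensity_eq_lintegral_mul _ (by fun_prop) (by fun_prop),
    ofReal_integral_eq_lintegral_ofReal (integrable_sqrt_mul_sqrt hp hq hp1 hq1)
      (ae_of_all _ fun z => by positivity)]
  refine lintegral_mono fun z => ?_
  simp only [Pi.mul_apply]
  by_cases h : q z = 0
  · simp [h]
  have hq0 : (0 : ℝ) < q z := by positivity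
  rw [← ENNReal.coe_div h, ← ENNReal.coe_rpow_of_nonneg _ (by norm_num), ← ENNReal.coe_mul]
  refine le_of_eq ?_
  rw [← ENNReal.ofReal_coe_nnreal]
  congr 1
  push_cast
  rw [← Real.sqrt_eq_rpow, Real.sqrt_div (p z).coe_nonneg]
  have h2 := Real.mul_self_sqrt (q z).coe_nonneg
  have h3 : √(q z : ℝ) ≠ 0 := (Real.sqrt_pos.2 hq0).ne'
  field_simp
  rw [sq, h2, mul_comm]

theorem lintegral_sqrt_ratio_le_exp (hp : Measurable p) (hq : Measurable q)
    (hp1 : ∫⁻ z, p z ∂ν = 1) (hq1 : ∫⁻ z, q z ∂ν = 1) {ε : ℝ} (hε : 0 < ε)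
    (h : ε ≤ ∫ z, |(p z : ℝ) - q z| ∂ν) :
    ∫⁻ z, ((p z : ℝ≥0∞) / q z) ^ (1 / 2 : ℝ) ∂ν.withDensity (fun z => (q z : ℝ≥0∞)) ≤
      ENNReal.ofReal (Real.exp (-(ε ^ 2 / 8))) := by
  refine (lintegral_sqrt_ratio_le hp hq hp1 hq1).trans (ENNReal.ofReal_le_ofReal ?_)
  have h1 := h.trans (integral_abs_sub_le_affinity hp hq hp1 hq1 (l := 4 / ε) (by positivity))
  have h2 := Real.add_one_le_exp (-(ε ^ 2 / 8))
  set α := ∫ z, √(p z : ℝ) * √(q z : ℝ) ∂ν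
  have h3 : 4 / ε * (1 - α) + 2 / (4 / ε) = (4 * (1 - α) + ε ^ 2 / 2) / ε := by
    field_simp; ring
  rw [h3, le_div_iff₀ hε] at h1
  nlinarith

theorem klFun_bound_of_klDiv_le (hp : Measurable p) (hq : Measurable q)
    (hp1 : ∫⁻ z, p z ∂ν = 1) (hq1 : ∫⁻ z, q z ∂ν = 1) {t : ℝ≥0∞} (ht : t ≠ ∞)
    (h : InformationTheory.klDiv (ν.withDensity fun z => (q z : ℝ≥0∞))
      (ν.withDensity fun z => (p z : ℝ≥0∞)) ≤ t) :
    (∀ᵐ z ∂ν, p z = 0 → q z = 0) ∧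
      ∫⁻ z, p z * ENNReal.ofReal (InformationTheory.klFun (q z / p z)) ∂ν ≤ t := by
  have := isProbabilityMeasure_withDensity_coe hp1
  have := isProbabilityMeasure_withDensity_coe hq1
  have hac := (InformationTheory.klDiv_ne_top_iff.1 (ne_top_of_le_ne_top ht h)).1
  have hs : MeasurableSet {z | p z = 0} := hp (measurableSet_singleton 0)
  have h0 : ∀ᵐ z ∂ν, p z = 0 → q z = 0 := by
    have h1 : ν.withDensity (fun z => (p z : ℝ≥0∞)) {z | p z = 0} = 0 := by
      rw [withDensity_apply _ hs, setLIntegral_congr_fun hs (g := fun _ => 0)]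
      · simp
      · intro z hz
        simpa using hz
    have h2 := hac h1
    rw [withDensity_apply _ hs, lintegral_eq_zero_iff (by fun_prop)] at h2
    have h3 := (ae_restrict_iff' hs).1 h2
    filter_upwards [h3] with z hz hz0
    simpa using hz hz0
  refine ⟨h0, ?_⟩
  have hr : Measurable fun z => ((q z / p z : ℝ≥0) : ℝ≥0∞) := (hq.div hp).coe_nnreal_ennreal
  have hmul : ν.withDensity (fun z => (q z : ℝ≥0∞)) =
      (ν.withDensity fun z => (p z : ℝ≥0∞)).withDensity fun z => ((q z / p z : ℝ≥0) : ℝ≥0∞) := by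
    rw [← withDensity_mul _ (by fun_prop) hr]
    refine withDensity_congr_ae ?_
    filter_upwards [h0] with z hz
    simp only [Pi.mul_apply]
    rw [← ENNReal.coe_mul]
    by_cases h : p z = 0
    · simp [h, hz h]
    · rw [mul_div_cancel₀ _ h]
  have hrn := Measure.rnDeriv_withDensity (ν.withDensity fun z => (p z : ℝ≥0∞)) hr
  rw [← hmul] at hrn
  rw [InformationTheory.klDiv_eq_lintegral_klFun_of_ac hac] at h
  refine le_trans (le_of_eq ?_) h
  have hkm : Measurable fun z => ENNReal.ofReal (InformationTheory.klFun (q z / p z)) := by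
    have := InformationTheory.measurable_klFun.comp
      (hq.coe_nnreal_real.div hp.coe_nnreal_real)
    exact this.ennreal_ofReal
  rw [lintegral_congr_ae (g := fun z => ENNReal.ofReal (InformationTheory.klFun (q z / p z)))
    (hrn.mono fun z hz => by simp [hz]),
    lintegral_withDensity_eq_lintegral_mul _ (by fun_prop) hkm]
  rfl

theorem sq_sqrt_sub_sqrt_le_mul_klFun {a b : ℝ} (ha : 0 ≤ a) (hb : 0 ≤ b) (h : a = 0 → b = 0) :
    a + b - 2 * (√a * √b) ≤ a * InformationTheory.klFun (b / a) := by
  rcases ha.eq_or_lt with rfl | ha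
  · simp [h rfl]
  have hs : 0 ≤ √(b / a) := Real.sqrt_nonneg _
  set s := √(b / a) with hsdef
  have hs2 : s ^ 2 = b / a := Real.sq_sqrt (by positivity)
  have hba : b = a * s ^ 2 := by rw [hs2]; field_simp
  have hsq : √a * √b = a * s := by
    rw [hba, Real.sqrt_mul ha.le, Real.sqrt_sq hs, ← mul_assoc, Real.mul_self_sqrt ha.le]
  have hk := InformationTheory.klFun_nonneg hs
  rw [hsq, ← hs2]
  have hba' : b = a * s ^ 2 := hba
  rw [hba']
  simp only [InformationTheory.klFun_apply, Real.log_pow] at hk ⊢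
  push_cast
  have : 0 ≤ 2 * a * (s * (s * Real.log s + 1 - s)) := by positivity
  nlinarith

theorem integral_abs_sub_le_of_klDiv_le (hp : Measurable p) (hq : Measurable q)
    (hp1 : ∫⁻ z, p z ∂ν = 1) (hq1 : ∫⁻ z, q z ∂ν = 1) {t : ℝ≥0}
    (h : InformationTheory.klDiv (ν.withDensity fun z => (q z : ℝ≥0∞))
      (ν.withDensity fun z => (p z : ℝ≥0∞)) ≤ t) {l : ℝ} (hl : 0 < l) :
    ∫ z, |(p z : ℝ) - q z| ∂ν ≤ l * (t / 2) + 2 / l := by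
  obtain ⟨h0, hk⟩ := klFun_bound_of_klDiv_le hp hq hp1 hq1 ENNReal.coe_ne_top h
  refine (integral_abs_sub_le_affinity hp hq hp1 hq1 hl).trans ?_
  have hpi := integrable_coe_of_lintegral_eq_one hp hp1
  have hqi := integrable_coe_of_lintegral_eq_one hq hq1
  have hai := (integrable_sqrt_mul_sqrt hp hq hp1 hq1).const_mul 2
  have hpq : Integrable (fun z => (p z : ℝ) + q z) ν := hpi.add hqi
  have key : ∫ z, ((p z : ℝ) + q z - 2 * (√(p z : ℝ) * √(q z : ℝ))) ∂ν ≤ t := by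
    have hnn : ∀ z, 0 ≤ (p z : ℝ) + q z - 2 * (√(p z : ℝ) * √(q z : ℝ)) := fun z => by
      have h1 := Real.sq_sqrt (p z).coe_nonneg
      have h2 := Real.sq_sqrt (q z).coe_nonneg
      nlinarith [sq_nonneg (√(p z : ℝ) - √(q z : ℝ))]
    have : ENNReal.ofReal (∫ z, ((p z : ℝ) + q z - 2 * (√(p z : ℝ) * √(q z : ℝ))) ∂ν) ≤ t := by
      have hi : Integrable (fun z => (p z : ℝ) + q z - 2 * (√(p z : ℝ) * √(q z : ℝ))) ν :=
        hpq.sub hai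
      rw [ofReal_integral_eq_lintegral_ofReal hi (ae_of_all _ hnn)]
      refine le_trans (lintegral_mono_ae ?_) hk
      filter_upwards [h0] with z hz
      rw [← ENNReal.ofReal_coe_nnreal, ← ENNReal.ofReal_mul (p z).coe_nonneg]
      exact ENNReal.ofReal_le_ofReal (sq_sqrt_sub_sqrt_le_mul_klFun (p z).coe_nonneg
        (q z).coe_nonneg fun h => by exact_mod_cast hz (by exact_mod_cast h))
    rw [← ENNReal.ofReal_coe_nnreal] at this
    exact (ENNReal.ofReal_le_ofReal_iff t.coe_nonneg).1 this
  rw [integral_sub hpq hai, integral_const_mul, integral_add hpi hqi,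
    integral_coe_of_lintegral_eq_one hp hp1, integral_coe_of_lintegral_eq_one hq hq1] at key
  have : l * (1 - ∫ z, √(p z : ℝ) * √(q z : ℝ) ∂ν) ≤ l * (t / 2) :=
    mul_le_mul_of_nonneg_left (by linarith) hl.le
  linarith

end Densities

section PriorMass

variable {Z Ω : Type*} [MeasurableSpace Z] [MeasurableSpace Ω]

theorem measurableSet_klFun_bound {ν : Measure Z} [SigmaFinite ν] {p : Ω → Z → ℝ≥0}
    (hp : Measurable fun y : Ω × Z => p y.1 y.2) {q : Z → ℝ≥0} (hq : Measurable q) (t : ℝ≥0∞) :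
    MeasurableSet {ω | (∀ᵐ z ∂ν, p ω z = 0 → q z = 0) ∧
      ∫⁻ z, p ω z * ENNReal.ofReal (InformationTheory.klFun (q z / p ω z)) ∂ν ≤ t} := by
  have hq' : Measurable fun y : Ω × Z => q y.2 := hq.comp measurable_snd
  rw [Set.ofPred_and]
  refine MeasurableSet.inter ?_ ?_
  · have hs : MeasurableSet {y : Ω × Z | p y.1 y.2 = 0 ∧ q y.2 ≠ 0} :=
      (hp (measurableSet_singleton 0)).inter (hq' (measurableSet_singleton 0)).compl
    have e : {ω | ∀ᵐ z ∂ν, p ω z = 0 → q z = 0} =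
        {ω | ν (Prod.mk ω ⁻¹' {y : Ω × Z | p y.1 y.2 = 0 ∧ q y.2 ≠ 0}) = 0} := by
      ext ω
      simp [ae_iff, Set.preimage]
    rw [e]
    exact measurable_measure_prodMk_left hs (measurableSet_singleton 0)
  · have hk : Measurable fun y : Ω × Z =>
        (p y.1 y.2 : ℝ≥0∞) * ENNReal.ofReal (InformationTheory.klFun (q y.2 / p y.1 y.2)) :=
      hp.coe_nnreal_ennreal.mul (InformationTheory.measurable_klFun.comp
        (hq'.coe_nnreal_real.div hp.coe_nnreal_real)).ennreal_ofReal
    exact hk.lintegral_prod_right' measurableSet_Iic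

theorem mul_log_ratio_eq {a b : ℝ} (h : a = 0 → b = 0) :
    b * Real.log (b / a) = a * InformationTheory.klFun (b / a) - a + b := by
  by_cases ha : a = 0
  · simp [ha, h ha]
  · rw [InformationTheory.klFun_apply]; field_simp; ring

/-- The mean log-likelihood ratio over a prior supported on a Kullback-Leibler ball. -/
theorem integrable_log_ratio_and_integral_le {ν : Measure Z} [SigmaFinite ν] (π : Measure Ω)
    [IsProbabilityMeasure π] {p : Ω → Z → ℝ≥0} (hp : Measurable fun y : Ω × Z => p y.1 y.2)
    (hp1 : ∀ ω, ∫⁻ z, p ω z ∂ν = 1) {q : Z → ℝ≥0} (hq : Measurable q)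
    (hq1 : ∫⁻ z, q z ∂ν = 1) {t : ℝ≥0}
    (hac : ∀ᵐ y ∂ν.prod π, p y.2 y.1 = 0 → q y.1 = 0)
    (hk : ∀ᵐ ω ∂π,
      ∫⁻ z, p ω z * ENNReal.ofReal (InformationTheory.klFun (q z / p ω z)) ∂ν ≤ t) :
    Integrable (fun y : Z × Ω => Real.log (q y.1 / p y.2 y.1))
        ((ν.withDensity fun z => (q z : ℝ≥0∞)).prod π) ∧
      ∫ y : Z × Ω, Real.log (q y.1 / p y.2 y.1)
        ∂(ν.withDensity fun z => (q z : ℝ≥0∞)).prod π ≤ t := by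
  have hp' : Measurable fun y : Z × Ω => p y.2 y.1 := hp.comp measurable_swap
  have hq' : Measurable fun y : Z × Ω => q y.1 := hq.comp measurable_fst
  have hpr : Measurable fun y : Z × Ω => (p y.2 y.1 : ℝ) := hp'.coe_nnreal_real
  have hqr : Measurable fun y : Z × Ω => (q y.1 : ℝ) := hq'.coe_nnreal_real
  have hprod : (ν.withDensity fun z => (q z : ℝ≥0∞)).prod π =
      (ν.prod π).withDensity fun y => (q y.1 : ℝ≥0∞) :=
    prod_withDensity_left (by fun_prop)
  have hp1' : ∫⁻ y : Z × Ω, p y.2 y.1 ∂ν.prod π = 1 := by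
    rw [lintegral_prod_symm' _ (by fun_prop)]
    simp [hp1]
  have hq1' : ∫⁻ y : Z × Ω, q y.1 ∂ν.prod π = 1 := by
    rw [lintegral_prod_symm' _ (by fun_prop)]
    simp [hq1]
  have hΦm : Measurable fun y : Z × Ω =>
      (p y.2 y.1 : ℝ) * InformationTheory.klFun (q y.1 / p y.2 y.1) :=
    hpr.mul (InformationTheory.measurable_klFun.comp (hqr.div hpr))
  have hΦ0 : ∀ y : Z × Ω, 0 ≤ (p y.2 y.1 : ℝ) * InformationTheory.klFun (q y.1 / p y.2 y.1) :=
    fun y => mul_nonneg (NNReal.coe_nonneg _) (InformationTheory.klFun_nonneg (by positivity))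
  have hΦ : ∫⁻ y : Z × Ω, ENNReal.ofReal
      ((p y.2 y.1 : ℝ) * InformationTheory.klFun (q y.1 / p y.2 y.1)) ∂ν.prod π ≤ t := by
    rw [lintegral_prod_symm' _ hΦm.ennreal_ofReal]
    calc _ ≤ ∫⁻ _, (t : ℝ≥0∞) ∂π := by
          refine lintegral_mono_ae ?_
          filter_upwards [hk] with ω hω
          refine le_trans (le_of_eq (lintegral_congr fun z => ?_)) hω
          rw [ENNReal.ofReal_mul (NNReal.coe_nonneg _), ENNReal.ofReal_coe_nnreal]
      _ = t := by simp
  have hΦi : Integrable (fun y : Z × Ω =>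
      (p y.2 y.1 : ℝ) * InformationTheory.klFun (q y.1 / p y.2 y.1)) (ν.prod π) := by
    refine ⟨hΦm.aestronglyMeasurable, ?_⟩
    rw [hasFiniteIntegral_iff_ofReal (ae_of_all _ hΦ0)]
    exact hΦ.trans_lt ENNReal.coe_lt_top
  have hpi := integrable_coe_of_lintegral_eq_one hp' hp1'
  have hqi := integrable_coe_of_lintegral_eq_one hq' hq1'
  have heq : (fun y : Z × Ω => q y.1 • Real.log (q y.1 / p y.2 y.1)) =ᵐ[ν.prod π] fun y =>
      (p y.2 y.1 : ℝ) * InformationTheory.klFun (q y.1 / p y.2 y.1) - p y.2 y.1 + q y.1 := by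
    filter_upwards [hac] with y hy
    exact mul_log_ratio_eq fun h => by exact_mod_cast hy (by exact_mod_cast h)
  have hΦp : Integrable (fun y : Z × Ω =>
      (p y.2 y.1 : ℝ) * InformationTheory.klFun (q y.1 / p y.2 y.1) - p y.2 y.1) (ν.prod π) :=
    hΦi.sub hpi
  rw [hprod]
  refine ⟨?_, ?_⟩
  · rw [integrable_withDensity_iff_integrable_smul hq', integrable_congr heq]
    exact hΦp.add hqi
  · rw [integral_withDensity_eq_integral_smul hq', integral_congr_ae heq,
      integral_add hΦp hqi, integral_sub hΦi hpi, integral_coe_of_lintegral_eq_one hp' hp1',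
      integral_coe_of_lintegral_eq_one hq' hq1', sub_add_cancel,
      integral_eq_lintegral_of_nonneg_ae (ae_of_all _ hΦ0) hΦm.aestronglyMeasurable]
    exact ENNReal.toReal_le_coe_of_le_coe hΦ

theorem exists_forall_measure_evidence_lt {ν : Measure Z} [SigmaFinite ν] (π : Measure Ω)
    [IsProbabilityMeasure π] {p : Ω → Z → ℝ≥0} (hp : Measurable fun y : Ω × Z => p y.1 y.2)
    (hp1 : ∀ ω, ∫⁻ z, p ω z ∂ν = 1) {q : Z → ℝ≥0} (hq : Measurable q)
    (hq1 : ∫⁻ z, q z ∂ν = 1) {t : ℝ≥0} {c : ℝ} (hc : t < c)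
    (hpos : 0 < π {ω | InformationTheory.klDiv (ν.withDensity fun z => (q z : ℝ≥0∞))
      (ν.withDensity fun z => (p ω z : ℝ≥0∞)) ≤ t}) {η : ℝ≥0∞} (hη : 0 < η) :
    ∃ N : ℕ, ∀ n ≥ N,
      Measure.pi (fun _ : Fin n => ν.withDensity fun z => (q z : ℝ≥0∞))
        {x | ∫⁻ ω, ∏ i, ((p ω (x i) : ℝ≥0∞) / q (x i)) ∂π <
          ENNReal.ofReal (Real.exp (-(n * c)))} ≤ η := by
  have := isProbabilityMeasure_withDensity_coe hq1
  have hpω : ∀ ω, Measurable (p ω) := fun ω => hp.comp measurable_prodMk_left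
  set B := {ω | (∀ᵐ z ∂ν, p ω z = 0 → q z = 0) ∧
      ∫⁻ z, p ω z * ENNReal.ofReal (InformationTheory.klFun (q z / p ω z)) ∂ν ≤ t} with hB
  have hBm : MeasurableSet B := measurableSet_klFun_bound hp hq t
  have hBpos : 0 < π B := hpos.trans_le (measure_mono fun ω hω =>
    klFun_bound_of_klDiv_le (hpω ω) hq (hp1 ω) hq1 ENNReal.coe_ne_top hω)
  set ρ := ProbabilityTheory.cond π B with hρ
  have : IsProbabilityMeasure ρ := ProbabilityTheory.cond_isProbabilityMeasure hBpos.ne'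
  have hmem : ∀ᵐ ω ∂ρ, ω ∈ B := ProbabilityTheory.ae_cond_mem hBm
  have hp' : Measurable fun y : Z × Ω => p y.2 y.1 := hp.comp measurable_swap
  have hq' : Measurable fun y : Z × Ω => q y.1 := hq.comp measurable_fst
  have hac : ∀ᵐ y ∂ν.prod ρ, p y.2 y.1 = 0 → q y.1 = 0 := by
    have hs : MeasurableSet {y : Z × Ω | ¬ (p y.2 y.1 = 0 → q y.1 = 0)} := by
      have : {y : Z × Ω | ¬ (p y.2 y.1 = 0 → q y.1 = 0)} =
          {y : Z × Ω | p y.2 y.1 = 0} ∩ {y : Z × Ω | q y.1 = 0}ᶜ := by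
        ext y; simp
      rw [this]
      exact (hp' (measurableSet_singleton 0)).inter (hq' (measurableSet_singleton 0)).compl
    rw [ae_iff, Measure.prod_apply_symm hs]
    refine (lintegral_congr_ae ?_).trans lintegral_zero
    filter_upwards [hmem] with ω hω
    exact ae_iff.1 hω.1
  obtain ⟨hLi, hLt⟩ := integrable_log_ratio_and_integral_le ρ hp hp1 hq hq1 hac
    (hmem.mono fun ω hω => hω.2)
  obtain ⟨c', hc1, hc2⟩ := exists_between hc
  have hRL : ∀ᵐ z ∂ν.withDensity (fun z => (q z : ℝ≥0∞)), ∀ᵐ ω ∂ρ,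
      ENNReal.ofReal (Real.exp (-Real.log (q z / p ω z))) ≤ (p ω z : ℝ≥0∞) / q z := by
    rw [ae_withDensity_iff (by fun_prop)]
    filter_upwards [Measure.ae_ae_of_ae_prod hac] with z hz hqz
    filter_upwards [hz] with ω hω
    have hq0 : q z ≠ 0 := by simpa using hqz
    have hp0 : p ω z ≠ 0 := fun h => hq0 (hω h)
    have hpos1 : (0 : ℝ) < q z := by positivity
    have hpos2 : (0 : ℝ) < p ω z := by positivity
    rw [← Real.log_inv, Real.exp_log (by positivity), inv_div, ← ENNReal.coe_div hq0,
      ← ENNReal.ofReal_coe_nnreal, NNReal.coe_div]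
  obtain ⟨N, hN⟩ := exists_forall_measure_lintegral_prod_lt
    (ν.withDensity fun z => (q z : ℝ≥0∞)) ρ
    (R := fun ω z => (p ω z : ℝ≥0∞) / q z) (L := fun ω z => Real.log (q z / p ω z))
    (hq'.coe_nnreal_real.div hp'.coe_nnreal_real).log hLi hRL (hLt.trans_lt hc1) hη
  have hbound : ∀ᶠ n : ℕ in atTop, ENNReal.ofReal (Real.exp (-(n * (c - c')))) < π B := by
    have h1 : Tendsto (fun n : ℕ => ENNReal.ofReal (Real.exp (-(n * (c - c'))))) atTop
        (𝓝 (ENNReal.ofReal 0)) := by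
      refine ENNReal.tendsto_ofReal (Real.tendsto_exp_atBot.comp ?_)
      exact tendsto_neg_atTop_atBot.comp
        (tendsto_natCast_atTop_atTop.atTop_mul_const (sub_pos.2 hc2))
    rw [ENNReal.ofReal_zero] at h1
    exact (tendsto_order.1 h1).2 _ hBpos
  obtain ⟨N', hN'⟩ := eventually_atTop.1 hbound
  refine ⟨max N N', fun n hn => ?_⟩
  refine (measure_mono fun x hx => ?_).trans (hN n (le_trans (le_max_left _ _) hn))
  simp only [Set.mem_ofPred_eq] at hx ⊢
  by_contra hcon
  refine absurd hx (not_lt.2 ?_)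
  have hcond : ∫⁻ ω, ∏ i, ((p ω (x i) : ℝ≥0∞) / q (x i)) ∂ρ ≤
      (π B)⁻¹ * ∫⁻ ω, ∏ i, ((p ω (x i) : ℝ≥0∞) / q (x i)) ∂π := by
    rw [hρ, ProbabilityTheory.cond, lintegral_smul_measure, smul_eq_mul]
    gcongr
    exact Measure.restrict_le_self
  calc ENNReal.ofReal (Real.exp (-(n * c)))
      = ENNReal.ofReal (Real.exp (-(n * (c - c')))) * ENNReal.ofReal (Real.exp (-(n * c'))) := by
        rw [ofReal_exp_mul]; congr 2; ring
    _ ≤ π B * ((π B)⁻¹ * ∫⁻ ω, ∏ i, ((p ω (x i) : ℝ≥0∞) / q (x i)) ∂π) := by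
        gcongr
        · exact (hN' n (le_trans (le_max_right _ _) hn)).le
        · exact (not_lt.1 hcon).trans hcond
    _ = _ := by
        rw [← mul_assoc, ENNReal.mul_inv_cancel hBpos.ne' (measure_ne_top _ _), one_mul]

end PriorMass

namespace TaskFamily

variable {S : Type u} {A : Type v} {Ω : Type w} [MeasurableSpace S] [MeasurableSpace Ω]

theorem measurable_density_apply (M : TaskFamily S A Ω) (s : S) (a : A) (ω : Ω) :
    Measurable (M.density s a ω) :=
  (M.measurable_density s a).comp measurable_prodMk_left

theorem isProbabilityMeasure_law (M : TaskFamily S A Ω) (s : S) (a : A) (ω : Ω) :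
    IsProbabilityMeasure (M.law s a ω) :=
  isProbabilityMeasure_withDensity_coe (M.lintegral_density s a ω)

theorem measurable_outcomeDist (M : TaskFamily S A Ω) (s : S) (a : A) (ω₀ : Ω) :
    Measurable fun ω => M.outcomeDist s a ω ω₀ := by
  have := M.sigmaFinite_base
  have h : Measurable fun y : Ω × (S × ℝ) =>
      |(M.density s a y.1 y.2 : ℝ) - M.density s a ω₀ y.2| := by
    have h1 := (M.measurable_density s a).coe_nnreal_real
    have h2 : Measurable fun y : Ω × (S × ℝ) => (M.density s a ω₀ y.2 : ℝ) :=
      ((M.measurable_density_apply s a ω₀).comp measurable_snd).coe_nnreal_real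
    exact (h1.sub h2).abs
  exact h.stronglyMeasurable.integral_prod_right'.measurable

theorem outcomeDist_le_two (M : TaskFamily S A Ω) (s : S) (a : A) (ω ω₀ : Ω) :
    M.outcomeDist s a ω ω₀ ≤ 2 :=
  integral_abs_sub_le_two (M.measurable_density_apply s a ω) (M.measurable_density_apply s a ω₀)
    (M.lintegral_density s a ω) (M.lintegral_density s a ω₀)

theorem transition_eq_setIntegral [MeasurableSingletonClass S] (M : TaskFamily S A Ω) (s : S)
    (a : A) (ω : Ω) (s' : S) :
    M.transition s a ω s' = ∫ z in {z | z.1 = s'}, (M.density s a ω z : ℝ) ∂M.base := by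
  have hs : MeasurableSet {z : S × ℝ | z.1 = s'} := measurable_fst (measurableSet_singleton s')
  rw [transition, law, measureReal_def, withDensity_apply _ hs,
    integral_eq_lintegral_of_nonneg_ae (ae_of_all _ fun _ => NNReal.coe_nonneg _)
      (M.measurable_density_apply s a ω).coe_nnreal_real.aestronglyMeasurable]
  simp

/-- Marginalizing out the reward does not increase the `L¹` distance. -/
theorem nextStateDist_le_outcomeDist [Fintype S] [MeasurableSingletonClass S]
    (M : TaskFamily S A Ω) (s : S) (a : A) (ω ω₀ : Ω) :
    M.nextStateDist s a ω ω₀ ≤ M.outcomeDist s a ω ω₀ := by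
  have hi : ∀ ω, Integrable (fun z => (M.density s a ω z : ℝ)) M.base := fun ω =>
    integrable_coe_of_lintegral_eq_one (M.measurable_density_apply s a ω)
      (M.lintegral_density s a ω)
  have hs : ∀ s' : S, MeasurableSet {z : S × ℝ | z.1 = s'} := fun s' =>
    measurable_fst (measurableSet_singleton s')
  have hU : (⋃ s' : S, {z : S × ℝ | z.1 = s'}) = Set.univ := by
    ext z; simp
  have hd : Integrable
      (fun z => |(M.density s a ω z : ℝ) - M.density s a ω₀ z|) M.base :=
    ((hi ω).sub (hi ω₀)).abs
  rw [outcomeDist, ← setIntegral_univ, ← hU, integral_iUnion_fintype hs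
    (fun i j hij => Set.disjoint_left.2 fun z hz hz' => hij (hz.symm.trans hz'))
    (fun i => hd.integrableOn)]
  refine Finset.sum_le_sum fun s' _ => ?_
  rw [transition_eq_setIntegral, transition_eq_setIntegral,
    ← integral_sub (hi ω).integrableOn (hi ω₀).integrableOn]
  exact abs_integral_le_integral_abs

theorem PosteriorConcentrates.mono_dist {M : TaskFamily S A Ω} {π : Measure Ω} {s : S} {a : A}
    {ω₀ : Ω} {dist dist' : Ω → Ω → ℝ} {ε δ ρ : ℝ} {n : ℕ}
    (h : M.PosteriorConcentrates π s a ω₀ dist ε δ ρ n) (hd : ∀ ω, dist' ω ω₀ ≤ dist ω ω₀) :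
    M.PosteriorConcentrates π s a ω₀ dist' ε δ ρ n :=
  le_trans h (measure_mono fun _ hx => le_trans hx (measure_mono fun _ hω =>
    lt_of_le_of_lt (hd _) hω))

theorem concentrationComplexity_le {M : TaskFamily S A Ω} {π : Measure Ω} {s : S} {a : A}
    {ω₀ : Ω} {dist : Ω → Ω → ℝ} {ε δ ρ : ℝ} {n : ℕ}
    (h : M.PosteriorConcentrates π s a ω₀ dist ε δ ρ n) :
    M.concentrationComplexity π s a ω₀ dist ε δ ρ ≤ n :=
  iInf₂_le n h

theorem posteriorConcentrates_zero {M : TaskFamily S A Ω} {π : Measure Ω} [IsProbabilityMeasure π]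
    {s : S} {a : A} {ω₀ : Ω} {dist : Ω → Ω → ℝ} {ε δ ρ : ℝ} (hδ : 0 ≤ δ) (hρ : 0 ≤ ρ)
    (h : π {ω | dist ω ω₀ < ε} = 1) :
    M.PosteriorConcentrates π s a ω₀ dist ε δ ρ 0 := by
  have := M.isProbabilityMeasure_law s a ω₀
  have hpost : ∀ x : Fin 0 → S × ℝ, M.posterior π s a x = π := fun x => by
    have : M.likelihood s a x = fun _ => 1 := by ext ω; simp [likelihood]
    rw [posterior, this]
    simp
  have hset : {x : Fin 0 → S × ℝ | ENNReal.ofReal (1 - ρ) ≤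
      M.posterior π s a x {ω | dist ω ω₀ < ε}} = Set.univ := by
    ext x
    simp [hpost, h, hρ]
  rw [PosteriorConcentrates, hset, measure_univ]
  exact ENNReal.ofReal_le_one.2 (by linarith)

theorem likelihood_eq_mul_prod_ratio (M : TaskFamily S A Ω) (s : S) (a : A) (ω₀ : Ω) {n : ℕ}
    {x : Fin n → S × ℝ} (hx : ∀ i, M.density s a ω₀ (x i) ≠ 0) (ω : Ω) :
    M.likelihood s a x ω = M.likelihood s a x ω₀ *
      ∏ i, ((M.density s a ω (x i) : ℝ≥0∞) / M.density s a ω₀ (x i)) := by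
  rw [likelihood, likelihood, ← Finset.prod_mul_distrib]
  refine Finset.prod_congr rfl fun i _ => ?_
  rw [ENNReal.mul_div_cancel (by simpa using hx i) ENNReal.coe_ne_top]

theorem le_posterior_of_setLIntegral_compl_le (M : TaskFamily S A Ω) (π : Measure Ω) (s : S)
    (a : A) (ω₀ : Ω) {n : ℕ} {x : Fin n → S × ℝ} (hx : ∀ i, M.density s a ω₀ (x i) ≠ 0)
    {G : Set Ω} (hG : MeasurableSet G) {ρ : ℝ} (hρ0 : 0 ≤ ρ) (hρ1 : ρ ≤ 1)
    (hpos : ∫⁻ ω, ∏ i, ((M.density s a ω (x i) : ℝ≥0∞) / M.density s a ω₀ (x i)) ∂π ≠ 0)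
    (hfin : ∫⁻ ω, ∏ i, ((M.density s a ω (x i) : ℝ≥0∞) / M.density s a ω₀ (x i)) ∂π ≠ ∞)
    (h : ∫⁻ ω in Gᶜ, ∏ i, ((M.density s a ω (x i) : ℝ≥0∞) / M.density s a ω₀ (x i)) ∂π ≤
      ENNReal.ofReal ρ *
        ∫⁻ ω, ∏ i, ((M.density s a ω (x i) : ℝ≥0∞) / M.density s a ω₀ (x i)) ∂π) :
    ENNReal.ofReal (1 - ρ) ≤ M.posterior π s a x G := by
  set f : Ω → ℝ≥0∞ := fun ω =>
    ∏ i, ((M.density s a ω (x i) : ℝ≥0∞) / M.density s a ω₀ (x i)) with hf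
  have hfm : Measurable f := Finset.measurable_prod _ fun i _ =>
    ((M.measurable_density s a).comp
      (measurable_id.prodMk measurable_const)).coe_nnreal_ennreal.div_const _
  set Q := M.likelihood s a x ω₀ with hQ
  have hQ0 : Q ≠ 0 := by
    simp only [hQ, likelihood, Finset.prod_ne_zero_iff]
    exact fun i _ => by simpa using hx i
  have hQt : Q ≠ ∞ := ENNReal.prod_ne_top fun i _ => ENNReal.coe_ne_top
  have hlik : M.likelihood s a x = fun ω => Q * f ω :=
    funext fun ω => M.likelihood_eq_mul_prod_ratio s a ω₀ hx ω
  rw [posterior, Measure.smul_apply, withDensity_apply _ hG, hlik, lintegral_const_mul _ hfm,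
    lintegral_const_mul _ hfm, smul_eq_mul, mul_comm, ← div_eq_mul_inv,
    ENNReal.mul_div_mul_left _ _ hQ0 hQt, ENNReal.le_div_iff_mul_le (Or.inl hpos) (Or.inl hfin)]
  have hsplit := lintegral_add_compl f (μ := π) hG
  have hone : ENNReal.ofReal (1 - ρ) * ∫⁻ ω, f ω ∂π + ENNReal.ofReal ρ * ∫⁻ ω, f ω ∂π =
      ∫⁻ ω, f ω ∂π := by
    rw [← add_mul, ← ENNReal.ofReal_add (by linarith) hρ0]
    simp
  have hne : ENNReal.ofReal ρ * ∫⁻ ω, f ω ∂π ≠ ∞ := ENNReal.mul_ne_top ENNReal.ofReal_ne_top hfin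
  refine (ENNReal.add_le_add_iff_right hne).1 ?_
  rw [hone]
  calc ∫⁻ ω, f ω ∂π = ∫⁻ ω in G, f ω ∂π + ∫⁻ ω in Gᶜ, f ω ∂π := hsplit.symm
    _ ≤ _ := by gcongr

theorem Consistent.eventually_exists_partition {M : TaskFamily S A Ω} {π : Measure Ω} {s : S}
    {a : A} (h : M.Consistent π s a 2) {θ : ℝ} (hθ : 0 < θ) :
    ∀ᶠ n : ℕ in atTop, ∃ P : Set (Set Ω), P.Countable ∧ (∀ B ∈ P, MeasurableSet B) ∧
      Setoid.IsPartition P ∧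
      ∑' B : P, π (B : Set Ω) ^ (2 / 3 : ℝ) * (1 + M.upperBracketingRadius s a B) ^ n ≤
        ENNReal.ofReal (Real.exp (n * θ)) := by
  have h1 := (tendsto_order.1 h).2 (θ : EReal) (by exact_mod_cast hθ)
  filter_upwards [h1, eventually_gt_atTop 0] with n hn hn0
  rw [criticalUpperBracketingRadius] at hn
  obtain ⟨P, hP⟩ := iInf_lt_iff.1 hn
  obtain ⟨⟨hc, hm, hp⟩, hlt⟩ := iInf_lt_iff.1 hP
  refine ⟨P, hc, hm, hp, ?_⟩
  rw [show ((2 : ℝ) - 1) / (2 - 1 / 2) = 2 / 3 by norm_num] at hlt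
  rw [EReal.div_lt_iff (by exact_mod_cast hn0)
    (EReal.natCast_ne_top n)] at hlt
  have e : (θ : EReal) * (n : EReal) = ENNReal.log (ENNReal.ofReal (Real.exp (n * θ))) := by
    rw [ENNReal.log_ofReal_of_pos (Real.exp_pos _), Real.log_exp]
    push_cast
    rw [mul_comm]
  rw [e] at hlt
  exact (ENNReal.log_lt_log_iff.1 hlt).le

/-- The likelihood ratio `p(z | s, a, ω) / p(z | s, a, ω₀)`. -/
noncomputable def ratio (M : TaskFamily S A Ω) (s : S) (a : A) (ω₀ ω : Ω) (z : S × ℝ) : ℝ≥0∞ :=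
  (M.density s a ω z : ℝ≥0∞) / M.density s a ω₀ z

theorem measurable_ratio (M : TaskFamily S A Ω) (s : S) (a : A) (ω₀ : Ω) :
    Measurable fun y : Ω × (S × ℝ) => M.ratio s a ω₀ y.1 y.2 :=
  (M.measurable_density s a).coe_nnreal_ennreal.div
    ((M.measurable_density_apply s a ω₀).comp measurable_snd).coe_nnreal_ennreal

theorem lintegral_ratio_le_one (M : TaskFamily S A Ω) (s : S) (a : A) (ω₀ ω : Ω) :
    ∫⁻ z, M.ratio s a ω₀ ω z ∂M.law s a ω₀ ≤ 1 := by
  have hm : Measurable (M.ratio s a ω₀ ω) :=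
    (M.measurable_ratio s a ω₀).comp measurable_prodMk_left
  rw [law, lintegral_withDensity_eq_lintegral_mul _
    (M.measurable_density_apply s a ω₀).coe_nnreal_ennreal hm, ← M.lintegral_density s a ω]
  exact lintegral_mono fun z => ENNReal.mul_div_le

theorem ae_density_ne_zero (M : TaskFamily S A Ω) (s : S) (a : A) (ω₀ : Ω) :
    ∀ᵐ z ∂M.law s a ω₀, M.density s a ω₀ z ≠ 0 := by
  rw [law, ae_withDensity_iff (M.measurable_density_apply s a ω₀).coe_nnreal_ennreal]
  exact ae_of_all _ fun z hz => by simpa using hz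

theorem ae_lintegral_prod_ratio_ne_top (M : TaskFamily S A Ω) (π : Measure Ω)
    [IsProbabilityMeasure π] (s : S) (a : A) (ω₀ : Ω) (n : ℕ) :
    ∀ᵐ x ∂Measure.pi (fun _ : Fin n => M.law s a ω₀),
      ∫⁻ ω, ∏ i, M.ratio s a ω₀ ω (x i) ∂π ≠ ∞ := by
  have := M.isProbabilityMeasure_law s a ω₀
  have hm : Measurable fun y : (Fin n → S × ℝ) × Ω => ∏ i, M.ratio s a ω₀ y.2 (y.1 i) :=
    Finset.measurable_prod _ fun i _ => (M.measurable_ratio s a ω₀).comp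
      (measurable_snd.prodMk ((measurable_pi_apply i).comp measurable_fst))
  refine (ae_lt_top hm.lintegral_prod_right' ?_).mono fun x hx => hx.ne
  rw [lintegral_lintegral_swap hm.aemeasurable]
  refine ne_top_of_le_ne_top ENNReal.one_ne_top ?_
  calc _ ≤ ∫⁻ _, 1 ∂π := by
        refine lintegral_mono fun ω => ?_
        rw [lintegral_pi_prod_eq_pow (M.law s a ω₀) n (f := M.ratio s a ω₀ ω)
          ((M.measurable_ratio s a ω₀).comp measurable_prodMk_left)]
        exact pow_le_one' (M.lintegral_ratio_le_one s a ω₀ ω) n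
    _ = 1 := by simp

theorem lintegral_essSup_ratio_le (M : TaskFamily S A Ω) (π : Measure Ω)
    [IsProbabilityMeasure π] (s : S) (a : A) (ω₀ : Ω) {B : Set Ω} (hB : MeasurableSet B) :
    ∫⁻ z, essSup (fun ω => M.ratio s a ω₀ ω z) (π.restrict B) ∂M.law s a ω₀ ≤
      1 + M.upperBracketingRadius s a B := by
  rw [law, lintegral_withDensity_eq_lintegral_mul _
    (M.measurable_density_apply s a ω₀).coe_nnreal_ennreal
    (measurable_essSup_of_measurable_uncurry _ (M.measurable_ratio s a ω₀))]
  refine le_trans (lintegral_mono fun z => ?_) le_add_tsub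
  refine le_trans (mul_le_mul_right (essSup_le_of_ae_le
    ((⨆ ω ∈ B, (M.density s a ω z : ℝ≥0∞)) / M.density s a ω₀ z) ?_) _) ENNReal.mul_div_le
  filter_upwards [ae_restrict_mem hB] with ω hω
  exact ENNReal.div_le_div_right
    (le_iSup₂ (f := fun ω (_ : ω ∈ B) => (M.density s a ω z : ℝ≥0∞)) ω hω) _

theorem measure_far_evidence_gt_le (M : TaskFamily S A Ω) (π : Measure Ω)
    [IsProbabilityMeasure π] (s : S) (a : A) (ω₀ : Ω) {n : ℕ} {θ : ℝ} {P : Set (Set Ω)}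
    (hPc : P.Countable) (hPm : ∀ B ∈ P, MeasurableSet B) (hP : Setoid.IsPartition P)
    (hsum : ∑' B : P, π (B : Set Ω) ^ (2 / 3 : ℝ) * (1 + M.upperBracketingRadius s a B) ^ n ≤
      ENNReal.ofReal (Real.exp (n * θ))) {ε : ℝ} (hε : 0 < ε) (β : ℝ) :
    Measure.pi (fun _ : Fin n => M.law s a ω₀)
        {x | ENNReal.ofReal (Real.exp (5 / 4 * β + 3 / 4 * (n * θ) - n * (ε ^ 2 / 8) / 2)) <
          ∫⁻ ω in {ω | M.outcomeDist s a ω ω₀ < ε}ᶜ, ∏ i, M.ratio s a ω₀ ω (x i) ∂π} ≤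
      ENNReal.ofReal (Real.exp (-β)) + ENNReal.ofReal (Real.exp (-β)) := by
  have := M.isProbabilityMeasure_law s a ω₀
  have := hPc.to_subtype
  refine measure_setLIntegral_prod_gt_le (M.law s a ω₀) π (M.measurable_ratio s a ω₀)
    ((M.measurable_outcomeDist s a ω₀) measurableSet_Iio).compl
    (Γ := fun B : P => (B : Set Ω)) (fun B => hPm B B.2)
    (fun B B' hne => hP.pairwiseDisjoint B.2 B'.2 fun h => hne (Subtype.ext h))
    (by rw [← Set.sUnion_eq_iUnion, hP.sUnion_eq_univ]) (fun ω hω => ?_)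
    (le_trans (ENNReal.tsum_le_tsum fun B => ?_) hsum) β
  · exact lintegral_sqrt_ratio_le_exp (M.measurable_density_apply s a ω)
      (M.measurable_density_apply s a ω₀) (M.lintegral_density s a ω)
      (M.lintegral_density s a ω₀) hε (not_lt.1 hω)
  · gcongr
    exact M.lintegral_essSup_ratio_le π s a ω₀ (hPm B B.2)

/-- If the posterior is consistent and the prior charges the Kullback-Leibler ball of radius `t`,
the posterior concentrates at exponential rate `ε ^ 2` on balls whose radius `ε` exceeds a
multiple of `√t`. -/
theorem exists_forall_posteriorConcentrates (M : TaskFamily S A Ω) (π : Measure Ω)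
    [IsProbabilityMeasure π] (s : S) (a : A) (ω₀ : Ω) (hcons : M.Consistent π s a 2)
    {t : ℝ≥0} (ht : 0 < t) (hball : 0 < π (M.klBall s a ω₀ t)) {δ₀ : ℝ} (hδ₀ : 0 < δ₀) :
    ∃ N : ℕ, ∀ n ≥ N, ∀ ε δ ρ : ℝ, 0 < ε → δ₀ ≤ δ → 0 < ρ → ρ < 1 → 128 * t ≤ ε ^ 2 →
      32 * Real.log (1 / ρ) ≤ n * ε ^ 2 →
      M.PosteriorConcentrates π s a ω₀ (M.outcomeDist s a) ε δ ρ n := by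
  have := M.sigmaFinite_base
  have := M.isProbabilityMeasure_law s a ω₀
  have ht' : (0 : ℝ) < t := ht
  obtain ⟨N₁, hN₁⟩ := exists_forall_measure_evidence_lt (ν := M.base) π (M.measurable_density s a)
    (M.lintegral_density s a) (M.measurable_density_apply s a ω₀) (M.lintegral_density s a ω₀)
    (t := t) (c := 2 * t) (by linarith) hball (η := ENNReal.ofReal (δ₀ / 2)) (by simpa using hδ₀)
  obtain ⟨N₂, hN₂⟩ := eventually_atTop.1 (hcons.eventually_exists_partition ht')
  obtain ⟨N₃, hN₃⟩ := exists_nat_ge (5 / 4 * Real.log (4 / δ₀) / t)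
  refine ⟨max N₁ (max N₂ N₃), fun n hn ε δ ρ hε hδ hρ0 hρ1 htε hnε => ?_⟩
  have hn₁ : N₁ ≤ n := (le_max_left _ _).trans hn
  have hn₂ : N₂ ≤ n := ((le_max_left _ _).trans (le_max_right _ _)).trans hn
  have hn₃ : N₃ ≤ n := ((le_max_right _ _).trans (le_max_right _ _)).trans hn
  obtain ⟨P, hPc, hPm, hP, hsum⟩ := hN₂ n hn₂
  have hβ : 5 / 4 * Real.log (4 / δ₀) ≤ n * t := by
    rw [← div_le_iff₀ ht']
    exact hN₃.trans (by exact_mod_cast hn₃)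
  have hexp : Real.exp (-Real.log (4 / δ₀)) = δ₀ / 4 := by
    rw [← Real.log_inv, Real.exp_log (by positivity), inv_div]
  have hbad₁ := hN₁ n hn₁
  have hbad₂ := M.measure_far_evidence_gt_le π s a ω₀ hPc hPm hP hsum hε (Real.log (4 / δ₀))
  rw [hexp, ← ENNReal.ofReal_add (by positivity) (by positivity)] at hbad₂
  have hG : MeasurableSet {ω | M.outcomeDist s a ω ω₀ < ε} :=
    (M.measurable_outcomeDist s a ω₀) measurableSet_Iio
  have hne : ∀ᵐ x ∂Measure.pi (fun _ : Fin n => M.law s a ω₀),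
      ∀ i, M.density s a ω₀ (x i) ≠ 0 := ae_all_iff.2 fun i =>
    (measurePreserving_eval (fun _ : Fin n => M.law s a ω₀) i).quasiMeasurePreserving.ae
      (M.ae_density_ne_zero s a ω₀)
  have hcompl : Measure.pi (fun _ : Fin n => M.law s a ω₀)
      {x | ENNReal.ofReal (1 - ρ) ≤
        M.posterior π s a x {ω | M.outcomeDist s a ω ω₀ < ε}}ᶜ ≤ ENNReal.ofReal δ := by
    calc _ ≤ Measure.pi (fun _ : Fin n => M.law s a ω₀)
          ({x | ∫⁻ ω, ∏ i, M.ratio s a ω₀ ω (x i) ∂π <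
              ENNReal.ofReal (Real.exp (-(n * (2 * t))))} ∪
            {x | ENNReal.ofReal (Real.exp (5 / 4 * Real.log (4 / δ₀) + 3 / 4 * (n * t) -
                n * (ε ^ 2 / 8) / 2)) <
              ∫⁻ ω in {ω | M.outcomeDist s a ω ω₀ < ε}ᶜ,
                ∏ i, M.ratio s a ω₀ ω (x i) ∂π}) := by
          refine measure_mono_ae ?_
          filter_upwards [hne, M.ae_lintegral_prod_ratio_ne_top π s a ω₀ n] with x hx hfin hxT
          by_contra hcon
          have hcon' : ¬ (_ ∨ _) := hcon
          simp only [Set.mem_ofPred_eq, not_or, not_lt] at hcon'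
          obtain ⟨hJ, hU⟩ := hcon'
          refine hxT (M.le_posterior_of_setLIntegral_compl_le π s a ω₀ hx hG hρ0.le hρ1.le
            (fun h0 => ?_) hfin ?_)
          · have : ENNReal.ofReal (Real.exp (-(n * (2 * t)))) ≤ 0 := hJ.trans h0.le
            simp only [nonpos_iff_eq_zero, ENNReal.ofReal_eq_zero] at this
            exact absurd (Real.exp_pos _) (not_lt.2 this)
          · refine hU.trans (le_trans ?_ (mul_le_mul_right hJ _))
            conv_rhs => rw [← Real.exp_log hρ0]
            rw [ofReal_exp_mul]
            refine ENNReal.ofReal_le_ofReal (Real.exp_le_exp.2 ?_)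
            rw [one_div, Real.log_inv] at hnε
            have := mul_le_mul_of_nonneg_left htε (Nat.cast_nonneg (α := ℝ) n)
            nlinarith [mul_nonneg (Nat.cast_nonneg (α := ℝ) n) ht'.le]
      _ ≤ ENNReal.ofReal (δ₀ / 2) + ENNReal.ofReal (δ₀ / 4 + δ₀ / 4) :=
          (measure_union_le _ _).trans (add_le_add hbad₁ hbad₂)
      _ = ENNReal.ofReal δ₀ := by
          rw [← ENNReal.ofReal_add (by positivity) (by positivity)]; congr 1; ring
      _ ≤ _ := ENNReal.ofReal_le_ofReal hδ
  rw [PosteriorConcentrates, ENNReal.ofReal_sub _ (hδ₀.le.trans hδ), ENNReal.ofReal_one,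
    tsub_le_iff_right, ← measure_univ (μ := Measure.pi (fun _ : Fin n => M.law s a ω₀)),
    ← Set.union_compl_self {x | ENNReal.ofReal (1 - ρ) ≤
        M.posterior π s a x {ω | M.outcomeDist s a ω ω₀ < ε}}]
  exact (measure_union_le _ _).trans (add_le_add le_rfl hcompl)

theorem ofReal_exp_neg_le_measure_klBall (M : TaskFamily S A Ω) (π : Measure Ω) (s : S) (a : A)
    (ω₀ : Ω) {t : ℝ} (h : M.priorMassRadius π s a ω₀ < ENNReal.ofReal t) :
    ENNReal.ofReal (Real.exp (-t)) ≤ π (M.klBall s a ω₀ (ENNReal.ofReal t)) := by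
  obtain ⟨d, hd, hdt⟩ := sInf_lt_iff.1 h
  have ht : 0 ≤ t := by
    by_contra hneg
    simp [ENNReal.ofReal_of_nonpos (not_le.1 hneg).le] at hdt
  have hd' : -ENNReal.log (π (M.klBall s a ω₀ d)) ≤ (d : EReal) := hd
  refine le_trans ?_ (measure_mono fun ω hω => le_trans hω hdt.le)
  rw [← ENNReal.log_le_log_iff, ENNReal.log_ofReal_of_pos (Real.exp_pos _), Real.log_exp,
    EReal.coe_neg]
  refine le_trans ?_ (EReal.neg_le.1 hd')
  rw [EReal.neg_le_neg_iff]
  calc (d : EReal) ≤ ((ENNReal.ofReal t : ℝ≥0∞) : EReal) := by exact_mod_cast hdt.le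
    _ = t := by rw [EReal.coe_ennreal_ofReal, max_eq_left ht]

/-- If the prior-mass radius vanishes, the prior is concentrated on the truth. -/
theorem measure_outcomeDist_lt_eq_one (M : TaskFamily S A Ω) (π : Measure Ω)
    [IsProbabilityMeasure π] (s : S) (a : A) (ω₀ : Ω) (h : M.priorMassRadius π s a ω₀ = 0)
    {ε : ℝ} (hε : 0 < ε) : π {ω | M.outcomeDist s a ω ω₀ < ε} = 1 := by
  refine le_antisymm prob_le_one ?_
  have hlim : Tendsto (fun t : ℝ => ENNReal.ofReal (Real.exp (-t))) (𝓝[>] 0) (𝓝 1) := by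
    have hc : Continuous fun t : ℝ => ENNReal.ofReal (Real.exp (-t)) :=
      ENNReal.continuous_ofReal.comp (Real.continuous_exp.comp continuous_neg)
    have := (hc.tendsto 0).mono_left (nhdsWithin_le_nhds (s := Set.Ioi 0))
    simpa using this
  refine le_of_tendsto hlim ?_
  filter_upwards [Ioo_mem_nhdsGT (show (0 : ℝ) < ε ^ 2 / 4 by positivity)] with t ht
  refine (M.ofReal_exp_neg_le_measure_klBall π s a ω₀ (by rw [h]; simpa using ht.1)).trans
    (measure_mono fun ω hω => ?_)
  have hb := integral_abs_sub_le_of_klDiv_le (ν := M.base) (t := t.toNNReal)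
    (M.measurable_density_apply s a ω) (M.measurable_density_apply s a ω₀)
    (M.lintegral_density s a ω) (M.lintegral_density s a ω₀) hω (l := 4 / ε) (by positivity)
  refine lt_of_le_of_lt hb ?_
  rw [Real.coe_toNNReal _ ht.1.le]
  have e : 4 / ε * (t / 2) + 2 / (4 / ε) = (2 * t + ε ^ 2 / 2) / ε := by field_simp; ring
  rw [e, div_lt_iff₀ hε]
  nlinarith [ht.2]

end TaskFamily

open TaskFamily in
theorem lemma4p3 :
    ∃ C : ℝ, 0 < C ∧
      ∀ (S : Type u) (A : Type v) (Ω : Type w) [Fintype S] [MeasurableSpace S]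
        [MeasurableSingletonClass S] [MeasurableSpace Ω]
        (M : TaskFamily S A Ω) (π : Measure Ω) [IsProbabilityMeasure π]
        (s : S) (a : A) (ω₀ : Ω),
        M.Consistent π s a 2 →
        ∀ d : ℝ, 0 ≤ d → M.priorMassRadius π s a ω₀ = ENNReal.ofReal d →
        ∃ K : ℝ, 0 < K ∧
          ∀ ε δ ρ : ℝ, 0 < ε → 0 < δ → δ < 1 → 0 < ρ → ρ < 1 →
            d < ε ^ 2 * δ →
            ((∀ t : ℝ≥0∞, 0 < t → 0 < π (M.klBall s a ω₀ t)) ∨ C * d ≤ ε ^ 2) →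
            ∀ dist : Ω → Ω → ℝ, (dist = M.nextStateDist s a ∨ dist = M.outcomeDist s a) →
              (M.concentrationComplexity π s a ω₀ dist ε δ ρ : ℝ≥0∞) ≤
                  ENNReal.ofReal (K * ((d + Real.log (1 / ρ)) / (ε ^ 2 * δ - d))) ∧
              (M.concentrationComplexity π s a ω₀ dist ε δ ρ : ℝ≥0∞) ≤
                  ENNReal.ofReal
                    (max K (C * ((d + Real.log (1 / ρ)) / (ε ^ 2 * δ - d)))) := by
  refine ⟨256, by norm_num, ?_⟩
  intro S A Ω _ _ _ _ M π _ s a ω₀ hcons d hd hrad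
  have hle : ∀ dist : Ω → Ω → ℝ, (dist = M.nextStateDist s a ∨ dist = M.outcomeDist s a) →
      ∀ ω, dist ω ω₀ ≤ M.outcomeDist s a ω ω₀ := by
    rintro dist (rfl | rfl) ω
    · exact M.nextStateDist_le_outcomeDist s a ω ω₀
    · exact le_rfl
  have hzero : ∀ ε δ ρ : ℝ, 0 < δ → 0 < ρ → π {ω | M.outcomeDist s a ω ω₀ < ε} = 1 →
      ∀ dist : Ω → Ω → ℝ, (dist = M.nextStateDist s a ∨ dist = M.outcomeDist s a) →
        M.concentrationComplexity π s a ω₀ dist ε δ ρ = 0 := fun ε δ ρ hδ hρ h dist hdist => by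
    have h0 := concentrationComplexity_le (M := M)
      ((posteriorConcentrates_zero (s := s) (a := a) hδ.le hρ.le h).mono_dist (hle dist hdist))
    simpa using h0
  rcases hd.eq_or_lt with rfl | hd
  · refine ⟨1, one_pos, fun ε δ ρ hε hδ _ hρ _ _ _ dist hdist => ?_⟩
    rw [hzero ε δ ρ hδ hρ
      (M.measure_outcomeDist_lt_eq_one π s a ω₀ (by simpa using hrad) hε) dist hdist]
    simp
  have hball : 0 < π (M.klBall s a ω₀ ((2 * d).toNNReal : ℝ≥0)) := by
    refine lt_of_lt_of_le ?_ (M.ofReal_exp_neg_le_measure_klBall π s a ω₀ (t := 2 * d) ?_)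
    · simpa using Real.exp_pos _
    · rw [hrad]; exact (ENNReal.ofReal_lt_ofReal_iff (by linarith)).2 (by linarith)
  obtain ⟨N₁, hN₁⟩ := M.exists_forall_posteriorConcentrates π s a ω₀ hcons
    (Real.toNNReal_pos.2 (by linarith)) hball (show 0 < d / 4 by positivity)
  obtain ⟨N₂, hN₂⟩ : ∃ N : ℕ, (∀ t : ℝ≥0, 0 < t → 0 < π (M.klBall s a ω₀ t)) →
      ∀ n ≥ N, ∀ ε δ ρ : ℝ, 0 < ε → d / 4 ≤ δ → 0 < ρ → ρ < 1 → d ≤ ε ^ 2 →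
      32 * Real.log (1 / ρ) ≤ n * ε ^ 2 →
      M.PosteriorConcentrates π s a ω₀ (M.outcomeDist s a) ε δ ρ n := by
    by_cases hall : ∀ t : ℝ≥0, 0 < t → 0 < π (M.klBall s a ω₀ t)
    · have hpos : 0 < (d / 128).toNNReal := Real.toNNReal_pos.2 (by positivity)
      obtain ⟨N, hN⟩ := M.exists_forall_posteriorConcentrates π s a ω₀ hcons hpos
        (hall _ hpos) (show 0 < d / 4 by positivity)
      refine ⟨N, fun _ n hn ε δ ρ hε hδ hρ0 hρ1 hdε => hN n hn ε δ ρ hε hδ hρ0 hρ1 ?_⟩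
      rw [Real.coe_toNNReal _ (by positivity)]
      linarith
    · exact ⟨0, fun h => absurd h hall⟩
  set N : ℕ := max (max N₁ N₂) 1 with hN
  have hNN₁ : N₁ ≤ N := (le_max_left _ _).trans (le_max_left _ _)
  have hNN₂ : N₂ ≤ N := (le_max_right _ _).trans (le_max_left _ _)
  have hN1 : (1 : ℝ) ≤ N := by exact_mod_cast le_max_right _ _
  refine ⟨max (2 * N) (max 64 (8 * N / d)), lt_max_of_lt_left (by linarith), ?_⟩
  intro ε δ ρ hε hδ0 hδ1 hρ0 hρ1 hdεδ hcase dist hdist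
  by_cases hε2 : 2 < ε
  · have huniv : {ω | M.outcomeDist s a ω ω₀ < ε} = Set.univ :=
      Set.eq_univ_of_forall fun ω => (M.outcomeDist_le_two s a ω ω₀).trans_lt hε2
    rw [hzero ε δ ρ hδ0 hρ0 (by rw [huniv, measure_univ]) dist hdist]
    simp
  have hεsq : ε ^ 2 ≤ 4 := by nlinarith
  have hε0 : 0 < ε ^ 2 := by positivity
  have hδd : d / 4 ≤ δ := by nlinarith
  have hdε : d ≤ ε ^ 2 := by nlinarith
  have hlog : 0 ≤ Real.log (1 / ρ) :=
    Real.log_nonneg (by rw [le_div_iff₀ hρ0]; linarith)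
  have hden : 0 < ε ^ 2 * δ - d := by linarith
  set y := Real.log (1 / ρ) / ε ^ 2 with hy
  set x := (d + Real.log (1 / ρ)) / (ε ^ 2 * δ - d) with hx
  have hxd : d / 4 ≤ x := by
    rw [hx, div_le_div_iff₀ (by norm_num) hden]
    have h4 : ε ^ 2 * δ - d ≤ 4 := by nlinarith
    have := mul_le_mul_of_nonneg_left h4 hd.le
    linarith
  have hyx : y ≤ x := by
    rw [hx, hy]
    exact div_le_div₀ (by linarith) (by linarith) hden (by nlinarith)
  set n : ℕ := ⌈max (N : ℝ) (32 * y)⌉₊ with hn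
  have hnge : max (N : ℝ) (32 * y) ≤ n := Nat.le_ceil _
  have hnN : N ≤ n := by exact_mod_cast (le_max_left _ _).trans hnge
  have hnle : (n : ℝ) ≤ max (2 * (N : ℝ)) (64 * y) := by
    have h1 := (Nat.ceil_lt_add_one (a := max (N : ℝ) (32 * y))
      (le_max_of_le_left (Nat.cast_nonneg _))).le
    have h2 : (1 : ℝ) ≤ max (N : ℝ) (32 * y) := le_max_of_le_left hN1
    have h3 : max (2 * (N : ℝ)) (64 * y) = 2 * max (N : ℝ) (32 * y) := by
      rw [mul_max_of_nonneg _ _ (by norm_num : (0 : ℝ) ≤ 2)]; congr 1; ring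
    rw [h3]; linarith
  have hny : 32 * Real.log (1 / ρ) ≤ n * ε ^ 2 := by
    have h1 : 32 * y ≤ n := (le_max_right _ _).trans hnge
    have h2 : y * ε ^ 2 = Real.log (1 / ρ) := div_mul_cancel₀ _ hε0.ne'
    nlinarith
  have hconc : M.PosteriorConcentrates π s a ω₀ (M.outcomeDist s a) ε δ ρ n := by
    rcases hcase with hall | hC
    · exact hN₂ (fun t ht => hall t (by exact_mod_cast ht)) n (hNN₂.trans hnN) ε δ ρ hε hδd hρ0 hρ1 hdε hny
    · refine hN₁ n (hNN₁.trans hnN) ε δ ρ hε hδd hρ0 hρ1 ?_ hny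
      rw [Real.coe_toNNReal _ (by linarith)]
      linarith
  have hf : (M.concentrationComplexity π s a ω₀ dist ε δ ρ : ℝ≥0∞) ≤ ENNReal.ofReal n := by
    rw [ENNReal.ofReal_natCast]
    have := concentrationComplexity_le (hconc.mono_dist (hle dist hdist))
    exact_mod_cast ENat.toENNReal_le.2 this
  have hx0 : 0 < x := lt_of_lt_of_le (by positivity) hxd
  refine ⟨hf.trans (ENNReal.ofReal_le_ofReal (hnle.trans (max_le ?_ ?_))),
    hf.trans (ENNReal.ofReal_le_ofReal (hnle.trans (max_le_max (le_max_left _ _) ?_)))⟩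
  · calc 2 * (N : ℝ) = 8 * N / d * (d / 4) := by field_simp; norm_num
      _ ≤ 8 * N / d * x := by gcongr
      _ ≤ _ := by
        gcongr
        exact (le_max_right _ _).trans (le_max_right _ _)
  · calc 64 * y ≤ 64 * x := by linarith
      _ ≤ _ := by
        gcongr
        exact (le_max_left _ _).trans (le_max_right _ _)
  · linarith
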